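/- Let $G$ be a locally compact Hausdorff unimodular group with unit $e$ and Haar measure $dx$. Let $\mathscr C=\bigsqcup_{x\in G}\mathfrak C_x$ be a Fell bundle over $G$, with product $\bullet$ and involution ${}^\bullet$, and let $C_c(G\,|\,\mathscr C)$ be the space of continuous cross-sections with compact support, with the convolution $(\Psi*\Phi)(x)=\int_G\Psi(y)\bullet\Phi(y^{-1}x)\,dy$ and the involution $\Phi^*(x)=\Phi(x^{-1})^\bullet$. For $\Phi\in C_c(G\,|\,\mathscr C)$ and $p\in[1,\infty)$ put $$\|\Phi\|_{L^p}=\Big(\int_G\|\Phi(x)\|_{\mathfrak C_x}^p\,dx\Big)^{1/p},\qquad \|\Phi\|_{L^\infty}=\operatorname*{ess\,sup}_{x\in G}\|\Phi(x)\|_{\mathfrak C_x},\qquad \|\Phi\|_{L^2_e}=\Big\|\int_G\Phi(x)^\bullet\bullet\Phi(x)\,dx\Big\|_{\mathfrak C_e}^{1/2}.$$ A $^*$-representation $\pi$ of $\mathscr C$ on a Hilbert space $\mathcal H$ (strongly continuous, that is, $a\mapsto\pi(a)\xi$ is continuous on $\mathscr C$ for each $\xi\in\mathcal H$) is called isometric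 if $\|\pi(a)\|=\|a\|$ for every element $a$ of every fibre, and non-degenerate if the vectors $\pi(a)\xi$ span a dense subspace of $\mathcal H$. For such a $\pi$ put $$\|\Phi\|_{\pi,p}=\sup_{\|\xi\|\le1}\Big(\int_G\|\pi(\Phi(x))\xi\|^p\,dx\Big)^{1/p}.$$ Let $\|\cdot\|_{C^*(G|\mathscr C)}$ be the norm of the universal $C^*$-completion of the Banach $^*$-algebra $L^1(G\,|\,\mathscr C)$. **(A)** Let $\pi$ be an isometric, non-degenerate $^*$-representation of $\mathscr C$ and let $\Phi,\Psi\in C_c(G\,|\,\mathscr C)$. Then: 1. $\|\Phi\|_{L^p}=\big(\int_G\|\pi(\Phi(x))\|^p\,dx\big)^{1/p}$ for all $p\in[1,\infty)$. 2. $\|\Phi\|_{\pi,2}=\|\Phi\|_{L^2_e}$. 3. $\lim_{p\to\infty}\|\Phi\|_{\pi,p}=\|\Phi\|_{L^\infty}$. 4. $\|\Psi*\Phi\|_{\pi,r}\le\|\Psi\|_{L^p}\|\Phi\|_{\pi,q}$ for all $p,q,r\in[1,\infty)$ with $1/p+1/q=1+1/r$. 5. $\|\Psi*\Phi\|_{L^\infty}\le\|\Psi\|_{L^p}\|\Phi\|_{\pi,q}$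 for all $p,q\in[1,\infty)$ with $1/p+1/q=1$. 6. If $G$ is discrete and its Haar measure is the counting measure, then $\|\Phi\|_{L^\infty}\le\|\Phi\|_{\pi,q}\le\|\Phi\|_{\pi,p}$ for all $1\le p\le q<\infty$, and $\|\Phi\|_{L^2_e}\le\|\Phi\|_{C^*(G|\mathscr C)}$. **(B)** (Strengthened Young's inequality) For all $\Phi,\Psi\in C_c(G\,|\,\mathscr C)$, $$\|\Psi*\Phi\|_{L^\infty}\le\|\Psi\|_{L^2}\|\Phi\|_{L^2_e}.$$ -/

import Mathlib

open MeasureTheory Filter Topology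
open scoped ENNReal

/-- The total space of a family of fibres over `G`. It carries no topology of its own: the topology
of a Fell bundle is a separate datum. (`Unit` fills the unused "model fibre" slot of
`Bundle.TotalSpace`.) -/
abbrev FellTotal {G : Type*} (C : G → Type*) : Type _ := Bundle.TotalSpace Unit C

/-- The element `a` of the fibre over `x`, as a point of the total space. -/
abbrev fellPt {G : Type*} {C : G → Type*} (x : G) (a : C x) : FellTotal C := ⟨x, a⟩

/-- A Fell bundle (`C*`-algebraic bundle) over a topological group `G`: a Banach bundle whose fibres
are the complex Banach spaces `C x`, with a continuous associative product `C x × C y → C (x * y)`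
and a continuous involution `C x → C x⁻¹`, such that `‖a⋆ a‖ = ‖a‖²` and `a⋆ a` is a positive
element of the unit fibre. Identities between elements of fibres which are only propositionally
equal are stated in the total space. -/
class FellBundle {G : Type*} [Group G] [TopologicalSpace G] (C : G → Type*)
    [∀ x, NormedAddCommGroup (C x)] [∀ x, NormedSpace ℂ (C x)] [∀ x, CompleteSpace (C x)]
    [TopologicalSpace (FellTotal C)] where
  /-- the product of the bundle -/
  mul : ∀ {x y : G}, C x → C y → C (x * y)
  /-- the involution of the bundle -/
  adj : ∀ {x : G}, C x → C x⁻¹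
  -- the Banach bundle
  t2Space : T2Space (FellTotal C)
  continuous_proj : Continuous (fun b : FellTotal C => b.proj)
  isOpenMap_proj : IsOpenMap (fun b : FellTotal C => b.proj)
  continuous_norm : Continuous (fun b : FellTotal C => ‖b.snd‖)
  /-- Addition is continuous on the pairs of points which lie in the same fibre; the domain
  carries the topology induced from the product of two copies of the total space. -/
  continuous_add : Continuous (fun p : Bundle.TotalSpace (Unit × Unit) (fun x => C x × C x) =>
    (fellPt p.proj (p.snd.1 + p.snd.2) : FellTotal C))
  continuous_smul : ∀ c : ℂ, Continuous (fun b : FellTotal C => fellPt b.proj (c • b.snd))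
  tendsto_zero : ∀ (x : G) (l : Filter (FellTotal C)),
    Tendsto (fun b : FellTotal C => ‖b.snd‖) l (𝓝 0) →
    Tendsto (fun b : FellTotal C => b.proj) l (𝓝 x) → Tendsto id l (𝓝 (fellPt x 0))
  -- the product
  add_mul : ∀ {x y : G} (a b : C x) (c : C y), mul (a + b) c = mul a c + mul b c
  mul_add : ∀ {x y : G} (a : C x) (b c : C y), mul a (b + c) = mul a b + mul a c
  smul_mul : ∀ {x y : G} (t : ℂ) (a : C x) (b : C y), mul (t • a) b = t • mul a b
  mul_smul : ∀ {x y : G} (t : ℂ) (a : C x) (b : C y), mul a (t • b) = t • mul a b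
  mul_assoc : ∀ {x y z : G} (a : C x) (b : C y) (c : C z),
    fellPt (x * y * z) (mul (mul a b) c) = fellPt (x * (y * z)) (mul a (mul b c))
  norm_mul_le : ∀ {x y : G} (a : C x) (b : C y), ‖mul a b‖ ≤ ‖a‖ * ‖b‖
  continuous_mul : Continuous (fun p : FellTotal C × FellTotal C =>
    fellPt (p.1.proj * p.2.proj) (mul p.1.snd p.2.snd))
  -- the involution
  adj_add : ∀ {x : G} (a b : C x), adj (a + b) = adj a + adj b
  adj_smul : ∀ {x : G} (t : ℂ) (a : C x), adj (t • a) = (starRingEnd ℂ t) • adj a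
  adj_mul : ∀ {x y : G} (a : C x) (b : C y),
    fellPt (x * y)⁻¹ (adj (mul a b)) = fellPt (y⁻¹ * x⁻¹) (mul (adj b) (adj a))
  adj_adj : ∀ {x : G} (a : C x), fellPt x⁻¹⁻¹ (adj (adj a)) = fellPt x a
  norm_adj : ∀ {x : G} (a : C x), ‖adj a‖ = ‖a‖
  continuous_adj : Continuous (fun b : FellTotal C => fellPt b.proj⁻¹ (adj b.snd))
  -- the `C*`-conditions; positivity in the unit fibre means being of the form `c⋆ c`
  norm_adj_mul_self : ∀ {x : G} (a : C x), ‖mul (adj a) a‖ = ‖a‖ ^ 2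
  exists_adj_mul_self : ∀ {x : G} (a : C x), ∃ c : C (1 : G),
    fellPt (x⁻¹ * x) (mul (adj a) a) = fellPt ((1 : G)⁻¹ * 1) (mul (adj c) c)

namespace FellBundle

/-- Transport between the fibres over two equal points. -/
def transport {G : Type*} {C : G → Type*} {x y : G} (h : x = y) (a : C x) : C y := h ▸ a

noncomputable section

variable {G : Type*} [Group G] [TopologicalSpace G] {C : G → Type*}
  [∀ x, NormedAddCommGroup (C x)] [∀ x, NormedSpace ℂ (C x)] [∀ x, CompleteSpace (C x)]
  [TopologicalSpace (FellTotal C)]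

/-- `Φ` is a continuous cross-section with compact support. -/
def IsCc (Φ : ∀ x, C x) : Prop :=
  Continuous (fun x => (fellPt x (Φ x) : FellTotal C)) ∧ IsCompact (closure {x | Φ x ≠ 0})

/-- The convolution `(Ψ * Φ)(x) = ∫ Ψ(y) • Φ(y⁻¹x) dy`, a Bochner integral in the fibre `C x`. -/
def conv [FellBundle C] [MeasurableSpace G] (μ : Measure G) (Ψ Φ : ∀ x, C x) : ∀ x, C x :=
  fun x => ∫ y, transport (mul_inv_cancel_left y x) (mul (Ψ y) (Φ (y⁻¹ * x))) ∂μ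

/-- The involution `Φ*(x) = Φ(x⁻¹)⋆` of cross-sections. -/
def invol [FellBundle C] (Φ : ∀ x, C x) : ∀ x, C x :=
  fun x => transport (inv_inv x) (adj (Φ x⁻¹))

/-- The `L^p`-norm of a cross-section, for finite `p`. -/
def lpNorm [MeasurableSpace G] (μ : Measure G) (p : ℝ) (Φ : ∀ x, C x) : ℝ≥0∞ :=
  (∫⁻ x, ‖Φ x‖ₑ ^ p ∂μ) ^ (1 / p)

/-- The `L^∞`-norm of a cross-section. -/
def linftyNorm [MeasurableSpace G] (μ : Measure G) (Φ : ∀ x, C x) : ℝ≥0∞ :=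
  essSup (fun x => ‖Φ x‖ₑ) μ

/-- The norm of the Hilbert module `L²_e`: `‖∫ Φ(x)⋆ • Φ(x) dx‖^{1/2}`, where the integral is a
Bochner integral in the unit fibre. -/
def l2eNorm [FellBundle C] [MeasurableSpace G] (μ : Measure G) (Φ : ∀ x, C x) : ℝ≥0∞ :=
  ‖∫ x, transport (C := C) (inv_mul_cancel x) (mul (adj (Φ x)) (Φ x)) ∂μ‖ₑ ^ (1 / 2 : ℝ)

/-- `N` restricts to a `C*`-seminorm on the `*`-algebra of continuous compactly supported
cross-sections which is dominated by the `L¹`-norm. As these cross-sections are dense in the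
Banach `*`-algebra of integrable cross-sections, and every `C*`-seminorm on the latter is
contractive, such `N` amount to the `C*`-seminorms on the algebra of integrable cross-sections. -/
structure IsCStarSeminorm [FellBundle C] [MeasurableSpace G] (μ : Measure G)
    (N : (∀ x, C x) → ℝ) : Prop where
  add_le : ∀ Φ Ψ, IsCc Φ → IsCc Ψ → N (Φ + Ψ) ≤ N Φ + N Ψ
  smul_eq : ∀ (t : ℂ) Φ, IsCc Φ → N (t • Φ) = ‖t‖ * N Φ
  conv_le : ∀ Φ Ψ, IsCc Φ → IsCc Ψ → N (conv μ Φ Ψ) ≤ N Φ * N Ψ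
  conv_invol_self : ∀ Φ, IsCc Φ → N (conv μ (invol Φ) Φ) = N Φ ^ 2
  le_lpNorm_one : ∀ Φ, IsCc Φ → ENNReal.ofReal (N Φ) ≤ lpNorm μ 1 Φ

/-- The norm of the universal `C*`-completion of the algebra of integrable cross-sections: the
largest `C*`-seminorm. -/
def cstarNorm [FellBundle C] [MeasurableSpace G] (μ : Measure G) (Φ : ∀ x, C x) : ℝ≥0∞ :=
  ⨆ N : {N : (∀ x, C x) → ℝ // IsCStarSeminorm μ N}, ENNReal.ofReal (N.1 Φ)

variable (C) in
/-- A `*`-representation of the Fell bundle on the Hilbert space `H`; continuity refers to the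
strong operator topology. -/
structure Representation [FellBundle C] (H : Type*) [NormedAddCommGroup H] [InnerProductSpace ℂ H]
    [CompleteSpace H] where
  /-- the operator which represents an element of a fibre -/
  op : ∀ {x : G}, C x → (H →L[ℂ] H)
  map_add : ∀ {x : G} (a b : C x), op (a + b) = op a + op b
  map_smul : ∀ {x : G} (t : ℂ) (a : C x), op (t • a) = t • op a
  map_mul : ∀ {x y : G} (a : C x) (b : C y), op (mul a b) = op a ∘L op b
  map_adj : ∀ {x : G} (a : C x), op (adj a) = ContinuousLinearMap.adjoint (op a)
  continuous_op : ∀ ξ : H, Continuous (fun b : FellTotal C => op b.snd ξ)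

section Representation

variable [FellBundle C] {H : Type*} [NormedAddCommGroup H] [InnerProductSpace ℂ H]
  [CompleteSpace H]

/-- The representation preserves the norms of the fibres. -/
def Representation.IsIsometric (π : Representation C H) : Prop :=
  ∀ (x : G) (a : C x), ‖π.op a‖ = ‖a‖

/-- The vectors `π(a) ξ` span a dense subspace. -/
def Representation.IsNondegenerate (π : Representation C H) : Prop :=
  Dense (Submodule.span ℂ {η : H | ∃ (x : G) (a : C x) (ξ : H), π.op a ξ = η} : Set H)

/-- `‖Φ‖_{π,p} = sup_{‖ξ‖ ≤ 1} (∫ ‖π(Φ(x)) ξ‖^p dx)^{1/p}`, for finite `p`. -/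
def Representation.piNorm [MeasurableSpace G] (π : Representation C H) (μ : Measure G) (p : ℝ)
    (Φ : ∀ x, C x) : ℝ≥0∞ :=
  ⨆ (ξ : H) (_ : ‖ξ‖ ≤ 1), (∫⁻ x, ‖π.op (Φ x) ξ‖ₑ ^ p ∂μ) ^ (1 / p)

end Representation

end

end FellBundle

/-!
Everything except the strengthened Young inequality and the comparison with the universal
`C⋆`-norm is obtained by applying an isometric representation `π` and working with the scalar
functions `x ↦ ‖π(Φ(x)) ξ‖`, which are continuous with compact support.

* The square of `‖Φ‖_{π,2}` is the supremum of the quadratic form of the positive operator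
  `π(∫ Φ(x)⋆ Φ(x) dx)`, hence its norm (`Representation.IsIsometric.piNorm_two`).
* Pointwise, `‖π((Ψ * Φ)(x)) ξ‖` is at most the scalar convolution of `‖Ψ‖` with `‖π(Φ(·)) ξ‖`
  (`Representation.IsIsometric.enorm_op_conv_le`), so the convolution inequalities follow from the
  classical ones, `young_inequality` and `lintegral_mul_translate_le`. The Haar measure need not
  be σ-finite or regular, so these are derived from Fubini's theorem for continuous functions with
  compact support; in particular unimodularity only gives invariance under inversion for the
  integrals of such functions (`integral_comp_inv_of_hasCompactSupport`).
* The strengthened Young inequality (`linftyNorm_conv_le`) has no representation at its disposal.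
  It is the Cauchy–Schwarz inequality for Hilbert modules over the unit fibre, which is a
  `C⋆`-algebra (`unitFibreCStarAlgebra`). With `b = (Ψ * Φ)(x)`, `a = Ψ(y)` and `c = Φ(y⁻¹ x)`, the
  element `(c - s a⋆ b)⋆ (c - s a⋆ b)` is positive and `(a⋆ b)⋆ (a⋆ b) ≤ ‖a‖² b⋆ b`
  (`fibreInner_mulTo_self_le`); integrating over `y` turns the cross terms into `b⋆ b`, and the
  choice `s = 1 / ‖Ψ‖₂²` (for `Ψ ≠ 0`) gives `b⋆ b ≤ ‖Ψ‖₂² ∫ Φ⋆ Φ`.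
* On a discrete group, `π` induces a regular representation on the square summable functions
  with values in the Hilbert space (`Representation.reg`). Its norm is a `C⋆`-seminorm, and
  evaluating it at functions supported at the unit bounds it below by `‖Φ‖_{π,2} = ‖Φ‖_{L²_e}`.
-/

namespace FellBundle

/-! ### Products between fibres and the unit fibre as a `C⋆`-algebra -/

section Transport

variable {G : Type*} {C : G → Type*}

/-- Equations between transported elements are the equations between points of the total space in
which the axioms of a Fell bundle are stated. -/
theorem transport_eq_iff {x y : G} (h : x = y) (a : C x) (b : C y) :
    transport h a = b ↔ fellPt x a = fellPt y b := by
  subst h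
  simp [transport]

theorem fellPt_transport {x y : G} (h : x = y) (a : C x) :
    fellPt y (transport h a) = fellPt x a :=
  ((transport_eq_iff h a _).1 rfl).symm

theorem transport_add [∀ x, NormedAddCommGroup (C x)] {x y : G} (h : x = y) (a b : C x) :
    transport h (a + b) = transport h a + transport h b := by
  subst h; rfl

theorem transport_smul [∀ x, NormedAddCommGroup (C x)] [∀ x, NormedSpace ℂ (C x)] {x y : G}
    (h : x = y) (t : ℂ) (a : C x) : transport h (t • a) = t • transport h a := by
  subst h; rfl

theorem norm_transport [∀ x, NormedAddCommGroup (C x)] {x y : G} (h : x = y) (a : C x) :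
    ‖transport h a‖ = ‖a‖ := by
  subst h; rfl

end Transport

section Fibres

variable {G : Type*} [Group G] [TopologicalSpace G] {C : G → Type*}
  [∀ x, NormedAddCommGroup (C x)] [∀ x, NormedSpace ℂ (C x)] [∀ x, CompleteSpace (C x)]
  [TopologicalSpace (FellTotal C)] [FellBundle C]

/-- The product of elements of the fibres over `x` and `y`, placed in the fibre over a given point
`z` which equals `x * y`. -/
def mulTo {x y z : G} (h : x * y = z) (a : C x) (b : C y) : C z := transport h (mul a b)

/-- The adjoint of an element of the fibre over `x`, placed in the fibre over a given point `z`
which equals `x⁻¹`. -/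
def adjTo {x z : G} (h : x⁻¹ = z) (a : C x) : C z := transport h (adj a)

theorem mulTo_assoc {x y z u v w : G} (h₁ : x * y = u) (h₂ : u * z = w) (h₃ : y * z = v)
    (h₄ : x * v = w) (a : C x) (b : C y) (c : C z) :
    mulTo h₂ (mulTo h₁ a b) c = mulTo h₄ a (mulTo h₃ b c) := by
  subst h₁ h₃ h₄
  exact (transport_eq_iff _ _ _).2 (mul_assoc a b c)

theorem adjTo_mulTo {x y z u v w : G} (h₁ : x * y = z) (h₂ : z⁻¹ = w) (h₃ : y⁻¹ = v)
    (h₄ : x⁻¹ = u) (h₅ : v * u = w) (a : C x) (b : C y) :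
    adjTo h₂ (mulTo h₁ a b) = mulTo h₅ (adjTo h₃ b) (adjTo h₄ a) := by
  subst h₁ h₃ h₄ h₅
  exact (transport_eq_iff _ _ _).2 (adj_mul a b)

theorem adjTo_adjTo {x z : G} (h₁ : x⁻¹ = z) (h₂ : z⁻¹ = x) (a : C x) :
    adjTo h₂ (adjTo h₁ a) = a := by
  subst h₁
  exact (transport_eq_iff _ _ _).2 (adj_adj a)

theorem norm_mulTo_le {x y z : G} (h : x * y = z) (a : C x) (b : C y) :
    ‖mulTo h a b‖ ≤ ‖a‖ * ‖b‖ := (norm_transport h _).trans_le (norm_mul_le a b)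

theorem norm_adjTo {x z : G} (h : x⁻¹ = z) (a : C x) : ‖adjTo h a‖ = ‖a‖ :=
  (norm_transport h _).trans (norm_adj a)

theorem mulTo_add {x y z : G} (h : x * y = z) (a : C x) (b c : C y) :
    mulTo h a (b + c) = mulTo h a b + mulTo h a c := by
  rw [mulTo, mul_add, transport_add]; rfl

theorem add_mulTo {x y z : G} (h : x * y = z) (a b : C x) (c : C y) :
    mulTo h (a + b) c = mulTo h a c + mulTo h b c := by
  rw [mulTo, add_mul, transport_add]; rfl

theorem mulTo_smul {x y z : G} (h : x * y = z) (t : ℂ) (a : C x) (b : C y) :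
    mulTo h a (t • b) = t • mulTo h a b := by
  rw [mulTo, mul_smul, transport_smul]; rfl

theorem smul_mulTo {x y z : G} (h : x * y = z) (t : ℂ) (a : C x) (b : C y) :
    mulTo h (t • a) b = t • mulTo h a b := by
  rw [mulTo, smul_mul, transport_smul]; rfl

theorem adjTo_add {x z : G} (h : x⁻¹ = z) (a b : C x) :
    adjTo h (a + b) = adjTo h a + adjTo h b := by
  rw [adjTo, adj_add, transport_add]; rfl

theorem adjTo_smul {x z : G} (h : x⁻¹ = z) (t : ℂ) (a : C x) :
    adjTo h (t • a) = starRingEnd ℂ t • adjTo h a := by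
  rw [adjTo, adj_smul, transport_smul]; rfl

/-- Left multiplication by an element of a fibre, as a bounded operator between fibres. -/
noncomputable def mulLeft {x y z : G} (h : x * y = z) (a : C x) : C y →L[ℂ] C z :=
  LinearMap.mkContinuous
    { toFun := mulTo h a
      map_add' := mulTo_add h a
      map_smul' := fun t b => mulTo_smul h t a b } ‖a‖ (norm_mulTo_le h a)

/-- Right multiplication by an element of a fibre, as an additive map between fibres. -/
def mulRight {x y z : G} (h : x * y = z) (b : C y) : C x →+ C z where
  toFun a := mulTo h a b
  map_zero' := by simpa using smul_mulTo h 0 0 b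
  map_add' a a' := add_mulTo h a a' b

theorem mulTo_zero {x y z : G} (h : x * y = z) (a : C x) : mulTo h a (0 : C y) = 0 :=
  (mulLeft h a).map_zero

theorem zero_mulTo {x y z : G} (h : x * y = z) (b : C y) : mulTo h (0 : C x) b = 0 :=
  (mulRight h b).map_zero

variable (C) in
/-- The unit fibre of a Fell bundle is a `C⋆`-algebra. -/
noncomputable abbrev unitFibreCStarAlgebra : NonUnitalCStarAlgebra (C (1 : G)) where
  __ := (inferInstance : NormedAddCommGroup (C 1))
  __ := (inferInstance : NormedSpace ℂ (C 1))
  __ := (inferInstance : CompleteSpace (C 1))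
  mul a b := mulTo (one_mul 1) a b
  left_distrib a b c := mulTo_add _ a b c
  right_distrib a b c := add_mulTo _ a b c
  zero_mul a := zero_mulTo _ a
  mul_zero a := mulTo_zero _ a
  mul_assoc a b c := mulTo_assoc _ _ _ _ a b c
  norm_mul_le a b := norm_mulTo_le _ a b
  star a := adjTo inv_one a
  star_involutive a := adjTo_adjTo _ _ a
  star_mul a b := adjTo_mulTo _ _ _ _ _ a b
  star_add a b := adjTo_add _ a b
  norm_mul_self_le a := by
    refine le_of_eq ?_
    -- `1⁻¹` and `1` are not definitionally equal, so the base point is generalized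
    have h : mulTo (one_mul 1) (adjTo inv_one a) a =
        transport (inv_mul_cancel 1) (mul (adj a) a) := by
      have key : ∀ {z : G} (h₁ : (1 : G)⁻¹ = z) (h₂ : z * 1 = 1),
          mulTo h₂ (adjTo h₁ a) a = transport (inv_mul_cancel 1) (mul (adj a) a) := by
        rintro z rfl h₂; rfl
      exact key _ _
    change ‖a‖ * ‖a‖ = ‖mulTo (one_mul 1) (adjTo inv_one a) a‖
    rw [h, norm_transport, norm_adj_mul_self, sq]
  smul_assoc t a b := smul_mulTo _ t a b
  smul_comm t a b := (mulTo_smul _ t a b).symm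
  star_smul t a := adjTo_smul _ t a

/-- The inner product `c⋆ d` of two elements of the same fibre, with values in the unit fibre. -/
def fibreInner {x : G} (c d : C x) : C (1 : G) := mulTo (inv_mul_cancel x) (adjTo rfl c) d

theorem fibreInner_eq {x z : G} (h₁ : x⁻¹ = z) (h₂ : z * x = 1) (c d : C x) :
    fibreInner c d = mulTo h₂ (adjTo h₁ c) d := by
  subst h₁; rfl

theorem fibreInner_add_left {x : G} (c c' d : C x) :
    fibreInner (c + c') d = fibreInner c d + fibreInner c' d := by
  simp only [fibreInner, adjTo_add, add_mulTo]

theorem fibreInner_add_right {x : G} (c d d' : C x) :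
    fibreInner c (d + d') = fibreInner c d + fibreInner c d' := mulTo_add _ _ _ _

theorem fibreInner_smul_left {x : G} (t : ℂ) (c d : C x) :
    fibreInner (t • c) d = starRingEnd ℂ t • fibreInner c d := by
  simp only [fibreInner, adjTo_smul, smul_mulTo]

theorem fibreInner_smul_right {x : G} (t : ℂ) (c d : C x) :
    fibreInner c (t • d) = t • fibreInner c d := mulTo_smul _ _ _ _

theorem norm_fibreInner_self {x : G} (c : C x) : ‖fibreInner c c‖ = ‖c‖ ^ 2 :=
  (norm_transport _ _).trans (norm_adj_mul_self c)

theorem adjTo_fibreInner {x : G} (c d : C x) :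
    adjTo inv_one (fibreInner c d) = fibreInner d c := by
  rw [fibreInner, adjTo_mulTo _ _ rfl (inv_inv x) (inv_mul_cancel x), adjTo_adjTo]
  rfl

/-- Left multiplication by `a` is adjointable for the inner products of the fibres, with adjoint
the left multiplication by `a⋆`. -/
theorem fibreInner_mulTo_left {x y z w : G} (h₁ : y * x = w) (h₂ : y⁻¹ = z) (h₃ : z * w = x)
    (a : C y) (b : C x) (c : C w) :
    fibreInner (mulTo h₁ a b) c = fibreInner b (mulTo h₃ (adjTo h₂ a) c) := by
  have h₅ : x⁻¹ * z = w⁻¹ := by rw [← h₁, ← h₂, mul_inv_rev]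
  rw [fibreInner, adjTo_mulTo h₁ rfl rfl h₂ h₅, fibreInner,
    mulTo_assoc h₅ (inv_mul_cancel w) h₃ (inv_mul_cancel x)]

section Order

attribute [local instance] unitFibreCStarAlgebra CStarAlgebra.spectralOrder
  CStarAlgebra.spectralOrderedRing

theorem mul_unitFibre (a b : C (1 : G)) : a * b = mulTo (one_mul 1) a b := rfl

theorem star_mul_self_unitFibre (a : C (1 : G)) : star a * a = fibreInner a a :=
  (fibreInner_eq inv_one (one_mul 1) a a).symm

theorem star_fibreInner {x : G} (c d : C x) : star (fibreInner c d) = fibreInner d c :=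
  adjTo_fibreInner c d

theorem fibreInner_self_nonneg {x : G} (c : C x) : 0 ≤ fibreInner c c := by
  obtain ⟨d, hd⟩ := exists_adj_mul_self c
  have : fibreInner c c = star d * d := by
    rw [star_mul_self_unitFibre]
    refine (transport_eq_iff _ _ _).2 (hd.trans (fellPt_transport _ _).symm)
  rw [this]
  exact star_mul_self_nonneg d

/-- Left multiplication by `a⋆` is bounded by `‖a‖` for the inner products of the fibres. The
positive element `‖a‖² - a a⋆` has the form `v⋆ v` in the unitization of the unit fibre, which acts
on all the fibres, and the difference of the two sides is `(v b)⋆ (v b)`. -/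
theorem fibreInner_mulTo_self_le {x y z w : G} (h₂ : y⁻¹ = z) (h₁ : z * x = w)
    (a : C y) (b : C x) :
    fibreInner (mulTo h₁ (adjTo h₂ a) b) (mulTo h₁ (adjTo h₂ a) b) ≤
      ((‖a‖ ^ 2 : ℝ) : ℂ) • fibreInner b b := by
  have hyz : y * z = 1 := by rw [← h₂, mul_inv_cancel]
  have hzy : z⁻¹ = y := by rw [← h₂, inv_inv]
  have hyw : y * w = x := by rw [← h₁, ← h₂, mul_inv_cancel_left]
  set A : C (1 : G) := mulTo hyz a (adjTo h₂ a) with hA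
  have hAeq : A = fibreInner (adjTo h₂ a) (adjTo h₂ a) := by
    rw [fibreInner_eq hzy hyz, adjTo_adjTo h₂ hzy]
  have hAnn : 0 ≤ A := hAeq ▸ fibreInner_self_nonneg _
  have hAnorm : ‖A‖ = ‖a‖ ^ 2 := by rw [hAeq, norm_fibreInner_self, norm_adjTo]
  have h1 : (A : Unitization ℂ (C (1 : G))) ≤ algebraMap ℝ _ (‖a‖ ^ 2) := by
    rw [← hAnorm, ← Unitization.norm_inr (𝕜 := ℂ)]
    exact IsSelfAdjoint.le_algebraMap_norm_self (.of_nonneg (Unitization.inr_nonneg_iff.2 hAnn))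
  obtain ⟨v, hv⟩ := CStarAlgebra.nonneg_iff_eq_star_mul_self.1 (sub_nonneg.2 h1)
  have hfst : ((‖a‖ ^ 2 : ℝ) : ℂ) = starRingEnd ℂ v.fst * v.fst := by
    have := congrArg (fun u => u.fst) hv
    simpa [Unitization.algebraMap_eq_inl_comp, sub_eq_add_neg] using this
  have hsnd : -A = starRingEnd ℂ v.fst • v.snd + v.fst • star v.snd + star v.snd * v.snd := by
    have := congrArg (fun u => u.snd) hv
    simpa [Unitization.algebraMap_eq_inl_comp, sub_eq_add_neg] using this
  have hL : fibreInner (mulTo h₁ (adjTo h₂ a) b) (mulTo h₁ (adjTo h₂ a) b) =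
      fibreInner b (mulTo (one_mul x) A b) := by
    rw [fibreInner_mulTo_left h₁ hzy hyw, adjTo_adjTo h₂ hzy,
      mulTo_assoc hyz (one_mul x) h₁ hyw]
  -- `v.fst • b + v.snd b` is the action of `v` on `b`
  have he := fibreInner_self_nonneg (v.fst • b + mulTo (one_mul x) v.snd b)
  have hexp : fibreInner (v.fst • b + mulTo (one_mul x) v.snd b)
      (v.fst • b + mulTo (one_mul x) v.snd b) =
      ((‖a‖ ^ 2 : ℝ) : ℂ) • fibreInner b b - fibreInner b (mulTo (one_mul x) A b) := by
    have hk : ∀ c : C x, fibreInner (mulTo (one_mul x) v.snd b) c =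
        fibreInner b (mulTo (one_mul x) (star v.snd) c) :=
      fun c => fibreInner_mulTo_left (one_mul x) inv_one (one_mul x) v.snd b c
    have hneg : -fibreInner b (mulTo (one_mul x) A b) =
        fibreInner b (mulTo (one_mul x) (-A) b) := by
      rw [← neg_one_smul ℂ A, smul_mulTo, fibreInner_smul_right, neg_one_smul]
    rw [sub_eq_add_neg, hneg, hsnd, hfst]
    simp only [fibreInner_add_left, fibreInner_add_right, fibreInner_smul_left,
      fibreInner_smul_right, hk, add_mulTo, smul_mulTo, mul_unitFibre,
      mulTo_assoc (one_mul 1) (one_mul x) (one_mul x) (one_mul x), smul_add]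
    rw [smul_smul, _root_.mul_comm v.fst]
    abel
  rw [hL, ← sub_nonneg, ← hexp]
  exact he

/-- The Cauchy–Schwarz inequality for the convolution product, with values in the unit fibre, in
the linearized form which results from the positivity of `(c - s a⋆ b)⋆ (c - s a⋆ b)`. -/
theorem smul_fibreInner_le {x y w : G} (h : y * w = x) (a : C y) (c : C w) (b : C x) (s : ℝ) :
    (s : ℂ) • (fibreInner b (mulTo h a c) + star (fibreInner b (mulTo h a c))) ≤
      fibreInner c c + ((s ^ 2 * ‖a‖ ^ 2 : ℝ) : ℂ) • fibreInner b b := by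
  have h' : y⁻¹ * x = w := by rw [← h, inv_mul_cancel_left]
  set d : C w := mulTo h' (adjTo rfl a) b with hd
  have hdc : fibreInner d c = fibreInner b (mulTo h a c) := by
    rw [hd, fibreInner_mulTo_left h' (inv_inv y) h, adjTo_adjTo]
  have hcd : fibreInner c d = star (fibreInner b (mulTo h a c)) := by
    rw [← hdc, star_fibreInner]
  have h0 := fibreInner_self_nonneg (c + (-s : ℂ) • d)
  have h1 := fibreInner_mulTo_self_le (rfl : y⁻¹ = y⁻¹) h' a b
  rw [← hd] at h1
  have hs : (starRingEnd ℂ) (-s : ℂ) = -s := by simp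
  simp only [fibreInner_add_left, fibreInner_add_right, fibreInner_smul_left,
    fibreInner_smul_right, hdc, hcd, hs] at h0
  have h2 : ((s ^ 2 : ℝ) : ℂ) • fibreInner d d ≤
      ((s ^ 2 * ‖a‖ ^ 2 : ℝ) : ℂ) • fibreInner b b := by
    have := smul_le_smul_of_nonneg_left h1 (sq_nonneg s)
    rw [Complex.ofReal_mul, ← smul_smul]
    exact this
  rw [← sub_nonneg]
  refine (add_nonneg h0 (sub_nonneg.2 h2)).trans_eq ?_
  push_cast
  module

end Order
end Fibres

/-! ### Fubini's theorem and Young's inequality on unimodular groups -/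

section Analysis

theorem lintegral_enorm_rpow_ne_top {X : Type*} [TopologicalSpace X] [MeasurableSpace X]
    [OpensMeasurableSpace X] (μ : Measure X) [IsFiniteMeasureOnCompacts μ] {f : X → ℝ}
    (hf : Continuous f) (hf' : HasCompactSupport f) {p : ℝ} (hp : 0 < p) :
    ∫⁻ x, ‖f x‖ₑ ^ p ∂μ ≠ ∞ := by
  have h := (hf.norm.rpow_const fun _ => .inr hp.le).integrable_of_hasCompactSupport (μ := μ)
    (hf'.norm.comp_left (g := fun t : ℝ => t ^ p) (Real.zero_rpow hp.ne'))
  refine ne_of_eq_of_ne (lintegral_congr fun x => ?_) h.hasFiniteIntegral.ne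
  rw [← enorm_norm (f x), Real.enorm_of_nonneg (norm_nonneg _),
    Real.enorm_of_nonneg (by positivity), ENNReal.ofReal_rpow_of_nonneg (norm_nonneg _) hp.le]

variable {G : Type*} [Group G] [TopologicalSpace G] [IsTopologicalGroup G]

/-- For compactly supported `f` and `g`, the function `(x, y) ↦ f y • g (y⁻¹ * x)` has compact
support. -/
theorem hasCompactSupport_smul_translate [T2Space G] {E : Type*} [NormedAddCommGroup E]
    [NormedSpace ℝ E] {f : G → ℝ} {g : G → E} (hf : HasCompactSupport f)
    (hg : HasCompactSupport g) :
    HasCompactSupport (Function.uncurry fun x y => f y • g (y⁻¹ * x)) := by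
  have hK : IsCompact ((fun p : G × G => (p.1 * p.2, p.1)) '' (tsupport f ×ˢ tsupport g)) :=
    (hf.isCompact.prod hg.isCompact).image (by fun_prop)
  refine HasCompactSupport.of_support_subset_isCompact hK ?_
  rintro ⟨x, y⟩ hxy
  have h := smul_ne_zero_iff.1 hxy
  exact ⟨(y, y⁻¹ * x), ⟨subset_tsupport _ h.1, subset_tsupport _ h.2⟩, by simp⟩

theorem hasCompactSupport_comp_inv_mul {E : Type*} [Zero E] {g : G → E}
    (hg : HasCompactSupport g) (x : G) : HasCompactSupport fun y => g (y⁻¹ * x) :=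
  hg.comp_homeomorph ((Homeomorph.inv G).trans (Homeomorph.mulRight x))

variable [T2Space G] [MeasurableSpace G] [BorelSpace G] (μ : Measure G) [μ.IsHaarMeasure]

theorem integral_integral_smul_translate {E : Type*} [NormedAddCommGroup E] [NormedSpace ℝ E]
    [CompleteSpace E] {f : G → ℝ} {g : G → E} (hf : Continuous f) (hf' : HasCompactSupport f)
    (hg : Continuous g) (hg' : HasCompactSupport g) :
    ∫ x, ∫ y, f y • g (y⁻¹ * x) ∂μ ∂μ = (∫ y, f y ∂μ) • ∫ x, g x ∂μ := by
  rw [integral_integral_swap_of_hasCompactSupport (by fun_prop)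
    (hasCompactSupport_smul_translate hf' hg')]
  simp only [integral_smul, integral_mul_left_eq_self g]
  exact integral_smul_const _ _

theorem lintegral_lintegral_mul_translate {f g : G → ℝ} (hf : Continuous f)
    (hf' : HasCompactSupport f) (hg : Continuous g) (hg' : HasCompactSupport g) :
    ∫⁻ x, ∫⁻ y, ‖f y‖ₑ * ‖g (y⁻¹ * x)‖ₑ ∂μ ∂μ = (∫⁻ y, ‖f y‖ₑ ∂μ) * ∫⁻ x, ‖g x‖ₑ ∂μ := by
  have hin : ∀ x, ∫⁻ y, ‖f y‖ₑ * ‖g (y⁻¹ * x)‖ₑ ∂μ =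
      ENNReal.ofReal (∫ y, ‖f y‖ • ‖g (y⁻¹ * x)‖ ∂μ) := fun x => by
    have hi : Integrable (fun y => f y * g (y⁻¹ * x)) μ :=
      Continuous.integrable_of_hasCompactSupport (by fun_prop) hf'.mul_right
    simp only [← enorm_mul, ← ofReal_integral_norm_eq_lintegral_enorm hi, norm_mul, smul_eq_mul]
  have hsupp := hasCompactSupport_smul_translate hf'.norm hg'.norm
  have hcont : Continuous fun x => ∫ y, ‖f y‖ • ‖g (y⁻¹ * x)‖ ∂μ := by
    rw [← continuousOn_univ]
    refine continuousOn_integral_of_compact_support hf'.isCompact (by fun_prop) ?_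
    intro x y _ hy
    simp [image_eq_zero_of_notMem_tsupport hy]
  have hcs : HasCompactSupport fun x => ∫ y, ‖f y‖ • ‖g (y⁻¹ * x)‖ ∂μ := by
    refine HasCompactSupport.of_support_subset_isCompact
      (hsupp.isCompact.image continuous_fst) fun x hx => ?_
    by_contra hx'
    refine hx (integral_eq_zero_of_ae (.of_forall fun y => ?_))
    by_contra hy
    exact hx' ⟨(x, y), subset_tsupport _ hy, rfl⟩
  simp only [hin]
  rw [← ofReal_integral_eq_lintegral_ofReal (hcont.integrable_of_hasCompactSupport hcs)
      (.of_forall fun x => integral_nonneg fun y => by positivity),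
    integral_integral_smul_translate μ hf.norm hf'.norm hg.norm hg'.norm, smul_eq_mul,
    ENNReal.ofReal_mul (integral_nonneg fun y => norm_nonneg _),
    ofReal_integral_norm_eq_lintegral_enorm (hf.integrable_of_hasCompactSupport hf'),
    ofReal_integral_norm_eq_lintegral_enorm (hg.integrable_of_hasCompactSupport hg')]

theorem lintegral_lintegral_rpow_mul_translate {f g : G → ℝ} (hf : Continuous f)
    (hf' : HasCompactSupport f) (hg : Continuous g) (hg' : HasCompactSupport g) {p q : ℝ}
    (hp : 0 < p) (hq : 0 < q) :
    ∫⁻ x, ∫⁻ y, ‖f y‖ₑ ^ p * ‖g (y⁻¹ * x)‖ₑ ^ q ∂μ ∂μ =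
      (∫⁻ y, ‖f y‖ₑ ^ p ∂μ) * ∫⁻ x, ‖g x‖ₑ ^ q ∂μ := by
  have h := lintegral_lintegral_mul_translate μ
    (hf.norm.rpow_const fun _ => .inr hp.le)
    (hf'.norm.comp_left (g := fun t : ℝ => t ^ p) (Real.zero_rpow hp.ne'))
    (hg.norm.rpow_const fun _ => .inr hq.le)
    (hg'.norm.comp_left (g := fun t : ℝ => t ^ q) (Real.zero_rpow hq.ne'))
  simpa only [Function.comp_apply, Real.enorm_rpow_of_nonneg (norm_nonneg _) hq.le,
    Real.enorm_rpow_of_nonneg (norm_nonneg _) hp.le, enorm_norm] using h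

variable [LocallyCompactSpace G]

/-- On a unimodular group, inversion preserves the integral of a continuous function with compact
support. The Haar measure is not assumed to be regular, so this says less than invariance of the
measure under inversion. -/
theorem integral_comp_inv_of_hasCompactSupport [μ.IsMulRightInvariant] {E : Type*}
    [NormedAddCommGroup E] [NormedSpace ℝ E] [CompleteSpace E]
    {g : G → E} (hg : Continuous g) (hg' : HasCompactSupport g) :
    ∫ y, g y⁻¹ ∂μ = ∫ y, g y ∂μ := by
  obtain ⟨f, hf', hf0, hf1⟩ := exists_continuous_nonneg_pos (1 : G)
  have hf := f.continuous
  have hpos := hf.integral_pos_of_hasCompactSupport_nonneg_nonzero (μ := μ) hf' hf0 hf1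
  have hfi : HasCompactSupport fun y => f y⁻¹ := hf'.comp_homeomorph (Homeomorph.inv G)
  have hgi : HasCompactSupport fun y => g y⁻¹ := hg'.comp_homeomorph (Homeomorph.inv G)
  -- the convolution of `f` with `g ∘ inv`, integrated in the two orders
  have h1 := integral_integral_smul_translate μ hf hf' (g := fun y => g y⁻¹)
    (by fun_prop) hgi
  have h2 : ∫ x, ∫ y, f y • g (y⁻¹ * x)⁻¹ ∂μ ∂μ = (∫ y, f y ∂μ) • ∫ x, g x ∂μ := by
    have : ∀ x, ∫ y, f y • g (y⁻¹ * x)⁻¹ ∂μ = ∫ y, f (x * y) • g y ∂μ := fun x => by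
      rw [← integral_mul_left_eq_self _ x]
      simp only [mul_inv_rev, inv_mul_cancel_right, inv_inv]
    simp only [this]
    rw [integral_integral_swap_of_hasCompactSupport (f := fun x y => f (x * y) • g y)]
    · simp only [integral_smul_const, integral_mul_right_eq_self f]
      rw [integral_smul]
    · fun_prop
    · have hK : IsCompact ((fun p : G × G => (p.1 * p.2⁻¹, p.2)) ''
          (tsupport f ×ˢ tsupport g)) :=
        (hf'.isCompact.prod hg'.isCompact).image (by fun_prop)
      refine HasCompactSupport.of_support_subset_isCompact hK ?_
      rintro ⟨x, y⟩ hxy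
      have h := smul_ne_zero_iff.1 hxy
      exact ⟨(x * y, y), ⟨subset_tsupport _ h.1, subset_tsupport _ h.2⟩, by simp⟩
  exact smul_right_injective E hpos.ne' (h1.symm.trans h2)

theorem integral_comp_inv_mul_of_hasCompactSupport [μ.IsMulRightInvariant] {E : Type*}
    [NormedAddCommGroup E] [NormedSpace ℝ E] [CompleteSpace E]
    {g : G → E} (hg : Continuous g) (hg' : HasCompactSupport g) (x : G) :
    ∫ y, g (y⁻¹ * x) ∂μ = ∫ y, g y ∂μ := by
  rw [← integral_comp_inv_of_hasCompactSupport μ hg hg', ← integral_mul_left_eq_self _ x]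
  simp

theorem lintegral_comp_inv_mul_of_hasCompactSupport [μ.IsMulRightInvariant]
    {g : G → ℝ} (hg : Continuous g) (hg' : HasCompactSupport g) (x : G) :
    ∫⁻ y, ‖g (y⁻¹ * x)‖ₑ ∂μ = ∫⁻ y, ‖g y‖ₑ ∂μ := by
  rw [← ofReal_integral_norm_eq_lintegral_enorm (hg.integrable_of_hasCompactSupport hg'),
    ← ofReal_integral_norm_eq_lintegral_enorm (f := fun y => g (y⁻¹ * x))
      (Continuous.integrable_of_hasCompactSupport (by fun_prop)
        (hasCompactSupport_comp_inv_mul hg' x)),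
    integral_comp_inv_mul_of_hasCompactSupport μ hg.norm hg'.norm]

theorem lintegral_rpow_comp_inv_mul [μ.IsMulRightInvariant] {g : G → ℝ} (hg : Continuous g)
    (hg' : HasCompactSupport g) {q : ℝ} (hq : 0 < q) (x : G) :
    ∫⁻ y, ‖g (y⁻¹ * x)‖ₑ ^ q ∂μ = ∫⁻ y, ‖g y‖ₑ ^ q ∂μ := by
  have h := lintegral_comp_inv_mul_of_hasCompactSupport μ
    (hg.norm.rpow_const fun _ => .inr hq.le)
    (hg'.norm.comp_left (g := fun t : ℝ => t ^ q) (Real.zero_rpow hq.ne')) x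
  simpa only [Function.comp_apply, Real.enorm_rpow_of_nonneg (norm_nonneg _) hq.le, enorm_norm]
    using h

/-- Hölder's inequality for a convolution of functions on a unimodular group. -/
theorem lintegral_mul_translate_le [μ.IsMulRightInvariant] {f g : G → ℝ} (hf : Continuous f)
    (hg : Continuous g) (hg' : HasCompactSupport g) {p q : ℝ} (hpq : p.HolderConjugate q) (x : G) :
    ∫⁻ y, ‖f y‖ₑ * ‖g (y⁻¹ * x)‖ₑ ∂μ ≤
      (∫⁻ y, ‖f y‖ₑ ^ p ∂μ) ^ (1 / p) * (∫⁻ y, ‖g y‖ₑ ^ q ∂μ) ^ (1 / q) := by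
  have h := ENNReal.lintegral_mul_le_Lp_mul_Lq μ hpq (f := fun y => ‖f y‖ₑ)
    (g := fun y => ‖g (y⁻¹ * x)‖ₑ) (by fun_prop) (by fun_prop)
  rwa [lintegral_rpow_comp_inv_mul μ hg hg' hpq.symm.pos] at h

/-- Young's inequality for continuous functions with compact support on a unimodular group. -/
theorem young_inequality [μ.IsMulRightInvariant] {f g : G → ℝ} (hf : Continuous f)
    (hf' : HasCompactSupport f) (hg : Continuous g) (hg' : HasCompactSupport g) {p q r : ℝ}
    (hp : 1 ≤ p) (hq : 1 ≤ q) (hr : 1 ≤ r) (h : 1 / p + 1 / q = 1 + 1 / r) :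
    (∫⁻ x, (∫⁻ y, ‖f y‖ₑ * ‖g (y⁻¹ * x)‖ₑ ∂μ) ^ r ∂μ) ^ (1 / r) ≤
      (∫⁻ y, ‖f y‖ₑ ^ p ∂μ) ^ (1 / p) * (∫⁻ y, ‖g y‖ₑ ^ q ∂μ) ^ (1 / q) := by
  have hp0 : 0 < p := by linarith
  have hq0 : 0 < q := by linarith
  have hr0 : 0 < r := by linarith
  have hb : 0 ≤ 1 / p - 1 / r := by
    have : 1 / q ≤ 1 := (div_le_one hq0).2 hq
    linarith
  have hc : 0 ≤ 1 / q - 1 / r := by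
    have : 1 / p ≤ 1 := (div_le_one hp0).2 hp
    linarith
  have ha : 0 ≤ 1 / r := by positivity
  set P := ∫⁻ y, ‖f y‖ₑ ^ p ∂μ with hP
  set Q := ∫⁻ y, ‖g y‖ₑ ^ q ∂μ with hQ
  have hPt : P ≠ ∞ := lintegral_enorm_rpow_ne_top μ hf hf' hp0
  have hQt : Q ≠ ∞ := lintegral_enorm_rpow_ne_top μ hg hg' hq0
  -- Hölder's inequality with the three weights `1/r`, `1/p - 1/r` and `1/q - 1/r`
  have hpt : ∀ x, ∫⁻ y, ‖f y‖ₑ * ‖g (y⁻¹ * x)‖ₑ ∂μ ≤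
      (∫⁻ y, ‖f y‖ₑ ^ p * ‖g (y⁻¹ * x)‖ₑ ^ q ∂μ) ^ (1 / r) *
        (P ^ (1 / p - 1 / r) * Q ^ (1 / q - 1 / r)) := fun x => by
    have hH := ENNReal.lintegral_prod_norm_pow_le (μ := μ) (Finset.univ : Finset (Fin 3))
      (f := ![fun y => ‖f y‖ₑ ^ p * ‖g (y⁻¹ * x)‖ₑ ^ q, fun y => ‖f y‖ₑ ^ p,
        fun y => ‖g (y⁻¹ * x)‖ₑ ^ q])
      (p := ![1 / r, 1 / p - 1 / r, 1 / q - 1 / r])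
      (by
        intro i _
        fin_cases i <;> simp only [Fin.zero_eta, Fin.mk_one, Fin.reduceFinMk, Matrix.cons_val] <;>
          fun_prop)
      (by simp only [Fin.sum_univ_three, Matrix.cons_val]; linarith)
      (by intro i _; fin_cases i; exacts [ha, hb, hc])
    simp only [Fin.prod_univ_three, Matrix.cons_val] at hH
    rw [lintegral_rpow_comp_inv_mul μ hg hg' hq0, _root_.mul_assoc] at hH
    refine le_of_eq_of_le (lintegral_congr fun y => ?_) hH
    have key : ∀ (a : ℝ≥0∞) {s : ℝ}, 0 < s → 0 ≤ 1 / s - 1 / r →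
        (a ^ s) ^ (1 / r) * (a ^ s) ^ (1 / s - 1 / r) = a := fun a s hs hsr => by
      rw [← ENNReal.rpow_add_of_nonneg _ _ ha hsr, ← ENNReal.rpow_mul, add_sub_cancel,
        mul_one_div_cancel hs.ne', ENNReal.rpow_one]
    rw [ENNReal.mul_rpow_of_nonneg _ _ ha, _root_.mul_assoc, mul_mul_mul_comm, key _ hp0 hb,
      key _ hq0 hc]
  set K := P ^ (1 / p - 1 / r) * Q ^ (1 / q - 1 / r) with hK
  have hKt : K ≠ ∞ := ENNReal.mul_ne_top (ENNReal.rpow_ne_top_of_nonneg hb hPt)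
    (ENNReal.rpow_ne_top_of_nonneg hc hQt)
  calc (∫⁻ x, (∫⁻ y, ‖f y‖ₑ * ‖g (y⁻¹ * x)‖ₑ ∂μ) ^ r ∂μ) ^ (1 / r)
      ≤ (∫⁻ x, (∫⁻ y, ‖f y‖ₑ ^ p * ‖g (y⁻¹ * x)‖ₑ ^ q ∂μ) * K ^ r ∂μ) ^ (1 / r) := by
        gcongr with x
        refine (ENNReal.rpow_le_rpow (hpt x) hr0.le).trans_eq ?_
        rw [ENNReal.mul_rpow_of_nonneg _ _ hr0.le, ← ENNReal.rpow_mul, one_div_mul_cancel hr0.ne',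
          ENNReal.rpow_one]
    _ = (P ^ (1 / r) * P ^ (1 / p - 1 / r)) * (Q ^ (1 / r) * Q ^ (1 / q - 1 / r)) := by
        rw [lintegral_mul_const' _ _ (ENNReal.rpow_ne_top_of_nonneg hr0.le hKt),
          lintegral_lintegral_rpow_mul_translate μ hf hf' hg hg' hp0 hq0,
          ENNReal.mul_rpow_of_nonneg _ _ ha, ENNReal.mul_rpow_of_nonneg _ _ ha,
          ← ENNReal.rpow_mul, mul_one_div_cancel hr0.ne', ENNReal.rpow_one, hK,
          mul_mul_mul_comm]
    _ = P ^ (1 / p) * Q ^ (1 / q) := by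
        rw [← ENNReal.rpow_add_of_nonneg _ _ ha hb, ← ENNReal.rpow_add_of_nonneg _ _ ha hc,
          add_sub_cancel, add_sub_cancel]

end Analysis

/-! ### Continuous sections and the strengthened Young inequality -/

section Support

variable {G : Type*} [TopologicalSpace G] {C : G → Type*} [∀ x, NormedAddCommGroup (C x)]
  [TopologicalSpace (FellTotal C)]

theorem IsCc.hasCompactSupport {Φ : ∀ x, C x} (hΦ : IsCc Φ) {E : Type*} [Zero E] {f : G → E}
    (hf : ∀ x, Φ x = 0 → f x = 0) : HasCompactSupport f :=
  hΦ.2.of_isClosed_subset isClosed_closure <|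
    closure_mono fun x (hx : f x ≠ 0) h => hx (hf x h)

theorem IsCc.hasCompactSupport_norm {Φ : ∀ x, C x} (hΦ : IsCc Φ) :
    HasCompactSupport fun x => ‖Φ x‖ := hΦ.hasCompactSupport fun x hx => by simp [hx]

end Support

section Sections

variable {G : Type*} [Group G] [TopologicalSpace G] {C : G → Type*}
  [∀ x, NormedAddCommGroup (C x)] [∀ x, NormedSpace ℂ (C x)] [∀ x, CompleteSpace (C x)]
  [TopologicalSpace (FellTotal C)]

/-- The topology of the total space of a Banach bundle induces the norm topology on each fibre:
the difference of two points of the same fibre depends continuously on the points. -/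
theorem continuous_of_continuous_fellPt [FellBundle C] {X : Type*} [TopologicalSpace X] {z : G}
    {f : X → C z} (hf : Continuous fun x => (fellPt z (f x) : FellTotal C)) : Continuous f := by
  refine continuous_iff_continuousAt.2 fun x₀ => tendsto_iff_norm_sub_tendsto_zero.2 ?_
  have h : Continuous fun x =>
      (⟨z, (f x, -f x₀)⟩ : Bundle.TotalSpace (Unit × Unit) fun x => C x × C x) :=
    (FiberBundle.Prod.isInducing_diag Unit C Unit C).continuous_iff.2
      (hf.prodMk (continuous_const (y := (fellPt z (-f x₀) : FellTotal C))))
  have h' := ((continuous_norm (C := C)).comp ((continuous_add (C := C)).comp h)).tendsto x₀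
  simpa [sub_eq_add_neg, Function.comp_def] using h'

theorem IsCc.continuous_norm [FellBundle C] {Φ : ∀ x, C x} (hΦ : IsCc Φ) :
    Continuous fun x => ‖Φ x‖ := (FellBundle.continuous_norm (C := C)).comp hΦ.1

variable [FellBundle C]

/-- A product of two continuous maps into the total space, the value of which stays in one fibre,
is continuous for the norm of that fibre. -/
theorem continuous_mulTo {X : Type*} [TopologicalSpace X] {z : G} {s t : X → G}
    {a : ∀ i, C (s i)} {b : ∀ i, C (t i)} (h : ∀ i, s i * t i = z)
    (ha : Continuous fun i => (fellPt (s i) (a i) : FellTotal C))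
    (hb : Continuous fun i => (fellPt (t i) (b i) : FellTotal C)) :
    Continuous fun i => mulTo (h i) (a i) (b i) := by
  refine continuous_of_continuous_fellPt ?_
  have := (continuous_mul (C := C)).comp (ha.prodMk hb)
  refine this.congr fun i => ?_
  exact (fellPt_transport _ _).symm

theorem IsCc.continuous_fibreInner_self {Φ : ∀ x, C x} (hΦ : IsCc Φ) :
    Continuous fun x => fibreInner (Φ x) (Φ x) :=
  continuous_mulTo (fun x => inv_mul_cancel x) ((continuous_adj (C := C)).comp hΦ.1) hΦ.1

theorem IsCc.hasCompactSupport_fibreInner_self {Φ : ∀ x, C x} (hΦ : IsCc Φ) :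
    HasCompactSupport fun x => fibreInner (Φ x) (Φ x) :=
  hΦ.hasCompactSupport fun x hx => by rw [hx, fibreInner, mulTo_zero]

theorem l2eNorm_eq [MeasurableSpace G] (μ : Measure G) (Φ : ∀ x, C x) :
    l2eNorm μ Φ = ‖∫ x, fibreInner (Φ x) (Φ x) ∂μ‖ₑ ^ (1 / 2 : ℝ) := rfl

theorem conv_eq [MeasurableSpace G] (μ : Measure G) (Ψ Φ : ∀ x, C x) (x : G) :
    conv μ Ψ Φ x = ∫ y, mulTo (mul_inv_cancel_left y x) (Ψ y) (Φ (y⁻¹ * x)) ∂μ := rfl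

theorem IsCc.integrable_norm_sq [MeasurableSpace G] [BorelSpace G] (μ : Measure G)
    [IsFiniteMeasureOnCompacts μ] {Φ : ∀ x, C x} (hΦ : IsCc Φ) :
    Integrable (fun y => ‖Φ y‖ ^ 2) μ :=
  Continuous.integrable_of_hasCompactSupport (hΦ.continuous_norm.pow 2)
    (hΦ.hasCompactSupport fun y hy => by simp [hy])

variable [IsTopologicalGroup G]

theorem IsCc.continuous_conv_integrand {Ψ Φ : ∀ x, C x} (hΨ : IsCc Ψ) (hΦ : IsCc Φ) (x : G) :
    Continuous fun y => mulTo (mul_inv_cancel_left y x) (Ψ y) (Φ (y⁻¹ * x)) :=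
  continuous_mulTo (fun y => mul_inv_cancel_left y x) hΨ.1
    (hΦ.1.comp (by fun_prop : Continuous fun y : G => y⁻¹ * x))

theorem IsCc.integrable_conv [MeasurableSpace G] [BorelSpace G] (μ : Measure G)
    [IsFiniteMeasureOnCompacts μ] {Ψ Φ : ∀ x, C x} (hΨ : IsCc Ψ) (hΦ : IsCc Φ) (x : G) :
    Integrable (fun y => mulTo (mul_inv_cancel_left y x) (Ψ y) (Φ (y⁻¹ * x))) μ :=
  (hΨ.continuous_conv_integrand hΦ x).integrable_of_hasCompactSupport
    (hΨ.hasCompactSupport fun y hy => by rw [hy, zero_mulTo])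

section Young

attribute [local instance] unitFibreCStarAlgebra CStarAlgebra.spectralOrder
  CStarAlgebra.spectralOrderedRing

variable [T2Space G] [LocallyCompactSpace G] [MeasurableSpace G] [BorelSpace G]
  (μ : Measure G) [μ.IsHaarMeasure] [μ.IsMulRightInvariant]

/-- The integrated Cauchy–Schwarz inequality at a point `x`: with `b` the value of the convolution
at `x`, the cross terms integrate to `b⋆ b`. -/
theorem smul_fibreInner_conv_le {Ψ Φ : ∀ x, C x} (hΨ : IsCc Ψ) (hΦ : IsCc Φ) (x : G) (s : ℝ) :
    ((2 * s - s ^ 2 * ∫ y, ‖Ψ y‖ ^ 2 ∂μ : ℝ) : ℂ) •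
      fibreInner (conv μ Ψ Φ x) (conv μ Ψ Φ x) ≤ ∫ y, fibreInner (Φ y) (Φ y) ∂μ := by
  set b := conv μ Ψ Φ x with hb
  set F : G → C x := fun y => mulTo (mul_inv_cancel_left y x) (Ψ y) (Φ (y⁻¹ * x)) with hF
  have hFi : Integrable F μ := hΨ.integrable_conv μ hΦ x
  have hFb : ∫ y, F y ∂μ = b := rfl
  set L : C x →L[ℂ] C (1 : G) := mulLeft (inv_mul_cancel x) (adjTo rfl b) with hL
  have hLF : ∫ y, L (F y) ∂μ = fibreInner b b := by
    rw [L.integral_comp_comm hFi, hFb]; rfl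
  have hstar : ∫ y, star (L (F y)) ∂μ = fibreInner b b := by
    have h := (starL' ℝ (A := C (1 : G))).toContinuousLinearMap.integral_comp_comm
      (L.integrable_comp hFi)
    rw [hLF] at h
    exact h.trans (star_fibreInner b b)
  have hsq := hΨ.integrable_norm_sq μ
  have hΦi : Integrable (fun y => fibreInner (Φ (y⁻¹ * x)) (Φ (y⁻¹ * x))) μ :=
    (hΦ.continuous_fibreInner_self.comp
      (by fun_prop : Continuous fun y : G => y⁻¹ * x)).integrable_of_hasCompactSupport
      (hasCompactSupport_comp_inv_mul hΦ.hasCompactSupport_fibreInner_self x)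
  have hstari : Integrable (fun y => star (L (F y))) μ :=
    (starL' ℝ (A := C (1 : G))).toContinuousLinearMap.integrable_comp (L.integrable_comp hFi)
  have hi₁ : Integrable (fun y => (s : ℂ) • (L (F y) + star (L (F y)))) μ :=
    ((L.integrable_comp hFi).add hstari).smul (s : ℂ)
  have hi₂ : Integrable (fun y => ((s ^ 2 * ‖Ψ y‖ ^ 2 : ℝ) : ℂ) • fibreInner b b) μ :=
    ((hsq.const_mul (s ^ 2)).ofReal (𝕜 := ℂ)).smul_const _
  have hmono := integral_mono hi₁ (hΦi.add hi₂) fun y =>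
    smul_fibreInner_le (mul_inv_cancel_left y x) (Ψ y) (Φ (y⁻¹ * x)) b s
  have h₁ : ∫ y, (s : ℂ) • (L (F y) + star (L (F y))) ∂μ =
      (s : ℂ) • (fibreInner b b + fibreInner b b) := by
    rw [integral_smul, integral_add (L.integrable_comp hFi) hstari, hLF, hstar]
  have h₂ : ∫ y, (fibreInner (Φ (y⁻¹ * x)) (Φ (y⁻¹ * x)) +
      ((s ^ 2 * ‖Ψ y‖ ^ 2 : ℝ) : ℂ) • fibreInner b b) ∂μ =
      ∫ y, fibreInner (Φ y) (Φ y) ∂μ +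
        ((s ^ 2 * ∫ y, ‖Ψ y‖ ^ 2 ∂μ : ℝ) : ℂ) • fibreInner b b := by
    rw [integral_add hΦi hi₂, integral_smul_const, integral_complex_ofReal, integral_const_mul,
      integral_comp_inv_mul_of_hasCompactSupport μ hΦ.continuous_fibreInner_self
        hΦ.hasCompactSupport_fibreInner_self]
  have hmono' := h₁.symm.trans_le (hmono.trans_eq h₂)
  rw [← sub_nonneg] at hmono' ⊢
  refine hmono'.trans_eq ?_
  push_cast
  module

/-- The strengthened Young inequality at a point. -/
theorem norm_conv_sq_le {Ψ Φ : ∀ x, C x} (hΨ : IsCc Ψ) (hΦ : IsCc Φ) (x : G) :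
    ‖conv μ Ψ Φ x‖ ^ 2 ≤ (∫ y, ‖Ψ y‖ ^ 2 ∂μ) * ‖∫ y, fibreInner (Φ y) (Φ y) ∂μ‖ := by
  set M := ∫ y, ‖Ψ y‖ ^ 2 ∂μ with hM
  set P := ∫ y, fibreInner (Φ y) (Φ y) ∂μ with hP
  have hM0 : 0 ≤ M := integral_nonneg fun y => sq_nonneg _
  have key : ∀ s : ℝ, 0 ≤ 2 * s - s ^ 2 * M →
      (2 * s - s ^ 2 * M) * ‖conv μ Ψ Φ x‖ ^ 2 ≤ ‖P‖ := fun s hs => by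
    have h0 : 0 ≤ ((2 * s - s ^ 2 * M : ℝ) : ℂ) •
        fibreInner (conv μ Ψ Φ x) (conv μ Ψ Φ x) :=
      (smul_nonneg hs (fibreInner_self_nonneg (conv μ Ψ Φ x)) :)
    have h := CStarAlgebra.norm_le_norm_of_nonneg_of_le h0 (smul_fibreInner_conv_le μ hΨ hΦ x s)
    rwa [norm_smul, norm_fibreInner_self, Complex.norm_real, Real.norm_of_nonneg hs] at h
  rcases hM0.eq_or_lt with hM0 | hM0
  · -- if `Ψ` vanishes then `s` may be taken arbitrarily large
    rw [← hM0] at key ⊢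
    by_contra! hlt
    rw [zero_mul] at hlt
    have h := key ((‖P‖ + 1) / ‖conv μ Ψ Φ x‖ ^ 2) (by rw [mul_zero, sub_zero]; positivity)
    rw [mul_zero, sub_zero, _root_.mul_assoc, div_mul_cancel₀ _ hlt.ne'] at h
    linarith [norm_nonneg P]
  · have hs : 2 * M⁻¹ - M⁻¹ ^ 2 * M = M⁻¹ := by field_simp; ring
    have h := key M⁻¹ (by rw [hs]; positivity)
    rwa [hs, inv_mul_le_iff₀ hM0] at h

theorem linftyNorm_conv_le {Ψ Φ : ∀ x, C x} (hΨ : IsCc Ψ) (hΦ : IsCc Φ) :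
    linftyNorm μ (conv μ Ψ Φ) ≤ lpNorm μ 2 Ψ * l2eNorm μ Φ := by
  refine essSup_le_of_ae_le _ (.of_forall fun x => ?_)
  have hΨ2 : ∫⁻ y, ‖Ψ y‖ₑ ^ (2 : ℝ) ∂μ = ENNReal.ofReal (∫ y, ‖Ψ y‖ ^ 2 ∂μ) := by
    rw [ofReal_integral_eq_lintegral_ofReal (hΨ.integrable_norm_sq μ)
      (.of_forall fun y => sq_nonneg _)]
    refine lintegral_congr fun y => ?_
    rw [ENNReal.ofReal_pow (norm_nonneg _), ofReal_norm, ENNReal.rpow_two]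
  have h := ENNReal.ofReal_le_ofReal (norm_conv_sq_le μ hΨ hΦ x)
  rw [ENNReal.ofReal_mul (integral_nonneg fun y => sq_nonneg _), ← hΨ2,
    ENNReal.ofReal_pow (norm_nonneg _), ofReal_norm, ofReal_norm, ← ENNReal.rpow_two] at h
  have h' := ENNReal.rpow_le_rpow h (by norm_num : (0 : ℝ) ≤ 1 / 2)
  rw [← ENNReal.rpow_mul, ENNReal.mul_rpow_of_nonneg _ _ (by norm_num : (0 : ℝ) ≤ 1 / 2)] at h'
  norm_num at h'
  rw [lpNorm, l2eNorm_eq]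
  norm_num
  exact h'

end Young

end Sections

/-! ### Limits and monotonicity of `L^p`-norms -/

section LpComparison

/-- `m ^ (1 / p)` tends to `1` as `p → ∞`, for `m` neither zero nor infinite. -/
theorem tendsto_const_rpow_one_div {m : ℝ≥0∞} (h0 : m ≠ 0) (ht : m ≠ ∞) :
    Tendsto (fun p : ℝ => m ^ (1 / p)) atTop (𝓝 1) := by
  lift m to NNReal using ht
  have hm : m ≠ 0 := by simpa using h0
  have hreal : Tendsto (fun p : ℝ => (m : ℝ) ^ (1 / p)) atTop (𝓝 ((m : ℝ) ^ (0 : ℝ))) := by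
    refine ((Real.continuous_const_rpow (by exact_mod_cast hm)).tendsto 0).comp ?_
    exact tendsto_inv_atTop_zero.congr fun p : ℝ => (one_div p).symm
  have h := ENNReal.tendsto_ofReal hreal
  simp only [Real.rpow_zero, ENNReal.ofReal_one] at h
  refine h.congr fun p => ?_
  rw [← ENNReal.ofReal_rpow_of_pos (by positivity), ENNReal.ofReal_coe_nnreal]

/-- A nonnegative function bounded by its own `L^p`-norm has decreasing `L^q`-norms. -/
theorem lintegral_rpow_antitone_of_le {X : Type*} [MeasurableSpace X] (μ : Measure X)
    {f : X → ℝ≥0∞} {p q : ℝ} (hp : 0 < p) (hpq : p ≤ q)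
    (hf : ∀ x, f x ≤ (∫⁻ x, f x ^ p ∂μ) ^ (1 / p)) :
    (∫⁻ x, f x ^ q ∂μ) ^ (1 / q) ≤ (∫⁻ x, f x ^ p ∂μ) ^ (1 / p) := by
  have hq : 0 < q := hp.trans_le hpq
  set S := ∫⁻ x, f x ^ p ∂μ with hS
  rcases eq_or_ne S ∞ with h | h
  · rw [h, ENNReal.top_rpow_of_pos (by positivity)]
    exact le_top
  have hk : 0 ≤ (q - p) / p := div_nonneg (sub_nonneg.2 hpq) hp.le
  have hle : ∫⁻ x, f x ^ q ∂μ ≤ S * S ^ ((q - p) / p) := by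
    rw [hS, ← lintegral_mul_const' _ _ (ENNReal.rpow_ne_top_of_nonneg hk h)]
    refine lintegral_mono fun x => ?_
    calc f x ^ q = f x ^ p * f x ^ (q - p) := by
          rw [← ENNReal.rpow_add_of_nonneg _ _ hp.le (sub_nonneg.2 hpq), add_sub_cancel]
      _ ≤ f x ^ p * (S ^ (1 / p)) ^ (q - p) := by
          gcongr
          exact hf x
      _ = f x ^ p * S ^ ((q - p) / p) := by
          rw [← ENNReal.rpow_mul, one_div_mul_eq_div]
  calc (∫⁻ x, f x ^ q ∂μ) ^ (1 / q) ≤ (S * S ^ ((q - p) / p)) ^ (1 / q) := by gcongr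
    _ = (S ^ (1 + (q - p) / p)) ^ (1 / q) := by
        rw [ENNReal.rpow_add_of_nonneg _ _ zero_le_one hk, ENNReal.rpow_one]
    _ = S ^ (1 / p) := by
        rw [← ENNReal.rpow_mul]
        congr 1
        field_simp
        ring

end LpComparison

/-! ### Isometric representations -/

section Representation

variable {G : Type*} [Group G] [TopologicalSpace G] {C : G → Type*}
  [∀ x, NormedAddCommGroup (C x)] [∀ x, NormedSpace ℂ (C x)] [∀ x, CompleteSpace (C x)]
  [TopologicalSpace (FellTotal C)] [FellBundle C]
  {H : Type*} [NormedAddCommGroup H] [InnerProductSpace ℂ H] [CompleteSpace H]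
  (π : Representation C H)

namespace Representation

theorem op_transport {x y : G} (h : x = y) (a : C x) : π.op (transport h a) = π.op a := by
  subst h; rfl

theorem op_mulTo {x y z : G} (h : x * y = z) (a : C x) (b : C y) :
    π.op (mulTo h a b) = π.op a ∘L π.op b := (π.op_transport h _).trans (π.map_mul a b)

theorem op_adjTo {x z : G} (h : x⁻¹ = z) (a : C x) :
    π.op (adjTo h a) = ContinuousLinearMap.adjoint (π.op a) :=
  (π.op_transport h _).trans (π.map_adj a)

theorem op_zero {x : G} : π.op (0 : C x) = 0 := by
  have h := π.map_smul (0 : ℂ) (0 : C x)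
  rwa [zero_smul, zero_smul] at h

theorem inner_op_fibreInner {x : G} (c d : C x) (ξ η : H) :
    inner ℂ ξ (π.op (fibreInner c d) η) = inner ℂ (π.op c ξ) (π.op d η) := by
  rw [fibreInner, op_mulTo, op_adjTo, ContinuousLinearMap.comp_apply,
    ContinuousLinearMap.adjoint_inner_right]

theorem continuous_op_section {Φ : ∀ x, C x} (hΦ : IsCc Φ) (ξ : H) :
    Continuous fun x => π.op (Φ x) ξ := (π.continuous_op ξ).comp hΦ.1

theorem hasCompactSupport_op_section {Φ : ∀ x, C x} (hΦ : IsCc Φ) (ξ : H) :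
    HasCompactSupport fun x => ‖π.op (Φ x) ξ‖ :=
  hΦ.hasCompactSupport fun x hx => by simp [hx, π.op_zero]

variable {π}

theorem IsIsometric.enorm_op (hπ : π.IsIsometric) {x : G} (a : C x) : ‖π.op a‖ₑ = ‖a‖ₑ := by
  rw [← enorm_norm, hπ, enorm_norm]

/-- An isometric representation restricted to a fibre and evaluated at a vector, as a bounded
operator. -/
noncomputable def IsIsometric.evalCLM (hπ : π.IsIsometric) (x : G) (ξ : H) : C x →L[ℂ] H :=
  LinearMap.mkContinuous
    { toFun := fun a => π.op a ξ
      map_add' := fun a b => by rw [π.map_add]; rfl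
      map_smul' := fun t a => by rw [π.map_smul]; rfl } ‖ξ‖
    fun a => by
      rw [_root_.mul_comm, ← hπ x a]
      exact (π.op a).le_opNorm ξ

theorem IsIsometric.op_integral (hπ : π.IsIsometric) {X : Type*} [MeasurableSpace X]
    {ν : Measure X} {x : G} {F : X → C x} (hF : Integrable F ν) (ξ : H) :
    π.op (∫ i, F i ∂ν) ξ = ∫ i, π.op (F i) ξ ∂ν :=
  ((hπ.evalCLM x ξ).integral_comp_comm hF).symm

theorem IsIsometric.enorm_op_apply_le (hπ : π.IsIsometric) {x : G} (a : C x) {ξ : H}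
    (hξ : ‖ξ‖ ≤ 1) : ‖π.op a ξ‖ₑ ≤ ‖a‖ₑ := by
  refine ((π.op a).le_opENorm ξ).trans ?_
  rw [hπ.enorm_op]
  have : ‖ξ‖ₑ ≤ 1 := by rw [← ofReal_norm]; exact ENNReal.ofReal_le_one.2 hξ
  exact mul_le_of_le_one_right' this

section Norm

variable [MeasurableSpace G] {μ : Measure G}

theorem lintegral_op_le_piNorm (π : Representation C H) (μ : Measure G) {p : ℝ} (hp : 0 < p)
    (Φ : ∀ x, C x) (ξ : H) :
    (∫⁻ x, ‖π.op (Φ x) ξ‖ₑ ^ p ∂μ) ^ (1 / p) ≤ π.piNorm μ p Φ * ‖ξ‖ₑ := by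
  rcases eq_or_ne ξ 0 with rfl | hξ
  · simp [hp]
  have hn : (‖ξ‖ : ℂ) ≠ 0 := by simpa using hξ
  set η : H := (‖ξ‖ : ℂ)⁻¹ • ξ with hη
  have hξη : ξ = (‖ξ‖ : ℂ) • η := by rw [hη, smul_inv_smul₀ hn]
  have hη1 : ‖η‖ ≤ 1 := by
    rw [hη, norm_smul, norm_inv, Complex.norm_real, norm_norm, inv_mul_cancel₀ (by simpa using hξ)]
  have he : ∀ x, ‖π.op (Φ x) ξ‖ₑ ^ p = ‖ξ‖ₑ ^ p * ‖π.op (Φ x) η‖ₑ ^ p := fun x => by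
    conv_lhs => rw [hξη, ContinuousLinearMap.map_smul, enorm_smul]
    rw [ENNReal.mul_rpow_of_nonneg _ _ hp.le]
    simp [enorm]
  simp only [he]
  rw [lintegral_const_mul' _ _ (ENNReal.rpow_ne_top_of_nonneg hp.le enorm_ne_top),
    ENNReal.mul_rpow_of_nonneg _ _ (by positivity), ← ENNReal.rpow_mul, mul_one_div_cancel hp.ne',
    ENNReal.rpow_one, _root_.mul_comm]
  gcongr
  exact le_iSup₂_of_le η hη1 le_rfl

theorem piNorm_le {p : ℝ} {Φ : ∀ x, C x} {c : ℝ≥0∞}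
    (h : ∀ ξ : H, ‖ξ‖ ≤ 1 → (∫⁻ x, ‖π.op (Φ x) ξ‖ₑ ^ p ∂μ) ^ (1 / p) ≤ c) :
    π.piNorm μ p Φ ≤ c := iSup₂_le h

theorem le_piNorm (p : ℝ) (Φ : ∀ x, C x) {ξ : H} (hξ : ‖ξ‖ ≤ 1) :
    (∫⁻ x, ‖π.op (Φ x) ξ‖ₑ ^ p ∂μ) ^ (1 / p) ≤ π.piNorm μ p Φ :=
  le_iSup₂_of_le ξ hξ le_rfl

theorem IsIsometric.lpNorm_eq (hπ : π.IsIsometric) (p : ℝ) (Φ : ∀ x, C x) :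
    lpNorm μ p Φ = (∫⁻ x, ‖π.op (Φ x)‖ₑ ^ p ∂μ) ^ (1 / p) := by
  simp only [lpNorm, hπ.enorm_op]

variable [BorelSpace G]

/-- The square of `‖Φ‖_{π,2}` is the norm of the positive operator `π(∫ Φ(x)⋆ Φ(x) dx)`, whose
quadratic form is `ξ ↦ ∫ ‖π(Φ(x)) ξ‖² dx`. -/
theorem IsIsometric.piNorm_two [IsFiniteMeasureOnCompacts μ] (hπ : π.IsIsometric)
    {Φ : ∀ x, C x} (hΦ : IsCc Φ) :
    π.piNorm μ 2 Φ = l2eNorm μ Φ := by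
  set A := ∫ x, fibreInner (Φ x) (Φ x) ∂μ with hA
  have hFi : Integrable (fun x => fibreInner (Φ x) (Φ x)) μ :=
    hΦ.continuous_fibreInner_self.integrable_of_hasCompactSupport
      hΦ.hasCompactSupport_fibreInner_self
  have hin : ∀ ξ η : H, inner ℂ ξ (π.op A η) = ∫ x, inner ℂ (π.op (Φ x) ξ) (π.op (Φ x) η) ∂μ :=
    fun ξ η => by
      rw [hA, hπ.op_integral hFi]
      refine (integral_inner ((hπ.evalCLM 1 η).integrable_comp hFi) ξ).symm.trans ?_
      exact integral_congr_ae (.of_forall fun x => π.inner_op_fibreInner _ _ ξ η)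
  refine le_antisymm ?_ ?_
  · refine piNorm_le fun ξ hξ => ?_
    rw [l2eNorm_eq, ← hA]
    refine ENNReal.rpow_le_rpow ?_ (by norm_num)
    have hi : Integrable (fun x => ‖π.op (Φ x) ξ‖ ^ 2) μ :=
      Continuous.integrable_of_hasCompactSupport ((π.continuous_op_section hΦ ξ).norm.pow 2)
        (hΦ.hasCompactSupport fun x hx => by simp [hx, π.op_zero])
    have h1 : ∫⁻ x, ‖π.op (Φ x) ξ‖ₑ ^ (2 : ℝ) ∂μ =
        ENNReal.ofReal (∫ x, ‖π.op (Φ x) ξ‖ ^ 2 ∂μ) := by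
      rw [ofReal_integral_eq_lintegral_ofReal hi (.of_forall fun x => sq_nonneg _)]
      refine lintegral_congr fun x => ?_
      rw [ENNReal.ofReal_pow (norm_nonneg _), ofReal_norm, ENNReal.rpow_two]
    have h2 : ((∫ x, ‖π.op (Φ x) ξ‖ ^ 2 ∂μ : ℝ) : ℂ) = inner ℂ ξ (π.op A ξ) := by
      rw [hin, ← integral_complex_ofReal]
      simp only [inner_self_eq_norm_sq_to_K]
      simp
    have h3 : ∫ x, ‖π.op (Φ x) ξ‖ ^ 2 ∂μ ≤ ‖A‖ := by
      calc _ ≤ ‖((∫ x, ‖π.op (Φ x) ξ‖ ^ 2 ∂μ : ℝ) : ℂ)‖ := by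
            rw [Complex.norm_real]; exact le_abs_self _
        _ ≤ ‖ξ‖ * (‖π.op A‖ * ‖ξ‖) := by
            rw [h2]
            exact (norm_inner_le_norm _ _).trans (by gcongr; exact (π.op A).le_opNorm ξ)
        _ ≤ 1 * (‖A‖ * 1) := by rw [hπ]; gcongr
        _ = ‖A‖ := by ring
    rw [h1, ← ofReal_norm A]
    exact ENNReal.ofReal_le_ofReal h3
  · set N := π.piNorm μ 2 Φ with hN
    have hcs : ∀ ξ η : H, ‖inner ℂ ξ (π.op A η)‖ₑ ≤ (N * ‖ξ‖ₑ) * (N * ‖η‖ₑ) := fun ξ η => by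
      have hm : ∀ ζ : H, AEMeasurable (fun x => ‖π.op (Φ x) ζ‖ₑ) μ := fun ζ =>
        (π.continuous_op_section hΦ ζ).enorm.measurable.aemeasurable
      calc ‖inner ℂ ξ (π.op A η)‖ₑ
          ≤ ∫⁻ x, ‖(inner ℂ (π.op (Φ x) ξ) (π.op (Φ x) η) : ℂ)‖ₑ ∂μ := by
            rw [hin]; exact enorm_integral_le_lintegral_enorm _
        _ ≤ ∫⁻ x, ((fun x => ‖π.op (Φ x) ξ‖ₑ) * fun x => ‖π.op (Φ x) η‖ₑ) x ∂μ := by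
            refine lintegral_mono fun x => ?_
            rw [Pi.mul_apply, ← ofReal_norm, ← ofReal_norm, ← ofReal_norm,
              ← ENNReal.ofReal_mul (norm_nonneg _)]
            exact ENNReal.ofReal_le_ofReal (norm_inner_le_norm _ _)
        _ ≤ _ := ENNReal.lintegral_mul_le_Lp_mul_Lq μ Real.HolderConjugate.two_two (hm ξ) (hm η)
        _ ≤ _ := mul_le_mul' (lintegral_op_le_piNorm π μ two_pos Φ ξ)
            (lintegral_op_le_piNorm π μ two_pos Φ η)
    have hop : ‖A‖ₑ ≤ N ^ (2 : ℝ) := by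
      rw [← hπ.enorm_op]
      refine ContinuousLinearMap.opENorm_le_bound _ fun η => ?_
      rcases eq_or_ne (π.op A η) 0 with h0 | h0
      · simp [h0]
      have h := hcs (π.op A η) η
      rw [← ofReal_norm (inner ℂ _ _ : ℂ), inner_self_eq_norm_sq_to_K, norm_pow, RCLike.norm_ofReal,
        abs_norm, ENNReal.ofReal_pow (norm_nonneg _), ofReal_norm, sq] at h
      have h' : ‖π.op A η‖ₑ * ‖π.op A η‖ₑ ≤ ‖π.op A η‖ₑ * (N ^ (2 : ℝ) * ‖η‖ₑ) := by
        refine h.trans_eq ?_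
        rw [ENNReal.rpow_two]
        ring
      exact (ENNReal.mul_le_mul_iff_right (by simpa using h0) enorm_ne_top).1 h'
    rw [l2eNorm_eq, ← hA]
    refine (ENNReal.rpow_le_rpow hop (by norm_num : (0 : ℝ) ≤ 1 / 2)).trans_eq ?_
    rw [← ENNReal.rpow_mul]
    norm_num

/-- For the lower bound, a vector `ξ` which nearly attains the norm of `π(Φ(x))` at a point `x`
where `‖Φ(x)‖` is nearly maximal works on a whole neighbourhood of `x`, by strong continuity. -/
theorem IsIsometric.tendsto_piNorm [μ.IsOpenPosMeasure] [IsFiniteMeasureOnCompacts μ]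
    (hπ : π.IsIsometric) {Φ : ∀ x, C x} (hΦ : IsCc Φ) :
    Tendsto (fun p : ℝ => π.piNorm μ p Φ) atTop (𝓝 (linftyNorm μ Φ)) := by
  set L := linftyNorm μ Φ with hL
  refine tendsto_order.2 ⟨fun a ha => ?_, fun a ha => ?_⟩
  · obtain ⟨c, hac, hcL⟩ := exists_between ha
    obtain ⟨x, hx⟩ : ∃ x, c < ‖Φ x‖ₑ := by
      by_contra! h
      exact hcL.not_ge (essSup_le_of_ae_le _ (.of_forall h))
    obtain ⟨ξ, hξ, hxξ⟩ : ∃ ξ : H, ‖ξ‖ ≤ 1 ∧ c < ‖π.op (Φ x) ξ‖ₑ := by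
      by_contra! h
      have hct : c ≠ ∞ := hcL.ne_top
      refine hx.not_ge ?_
      rw [← hπ.enorm_op, ← ofReal_norm, ENNReal.ofReal_le_iff_le_toReal hct]
      refine ContinuousLinearMap.opNorm_le_of_unit_norm ENNReal.toReal_nonneg fun ξ hξ => ?_
      rw [← ENNReal.ofReal_le_iff_le_toReal hct, ofReal_norm]
      exact h ξ hξ.le
    -- `‖π(Φ(·)) ξ‖` exceeds `c` on a neighbourhood `U` of `x`
    set U := {y | c < ‖π.op (Φ y) ξ‖ₑ} with hU
    have hUo : IsOpen U := isOpen_lt continuous_const (π.continuous_op_section hΦ ξ).enorm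
    have hUpos : μ U ≠ 0 := (hUo.measure_pos μ ⟨x, hxξ⟩).ne'
    set m := min (μ U) 1 with hm
    have hlim : Tendsto (fun p : ℝ => c * m ^ (1 / p)) atTop (𝓝 (c * 1)) :=
      ENNReal.Tendsto.const_mul (tendsto_const_rpow_one_div (by simp [hm, hUpos])
        (ne_top_of_le_ne_top ENNReal.one_ne_top (min_le_right _ _))) (.inl one_ne_zero)
    rw [mul_one] at hlim
    filter_upwards [hlim.eventually (lt_mem_nhds hac), eventually_gt_atTop 0] with p hp hp0
    refine hp.trans_le (le_trans ?_ (le_piNorm p Φ hξ))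
    calc c * m ^ (1 / p) ≤ c * μ U ^ (1 / p) := by gcongr; exact min_le_left _ _
      _ = (c ^ p * μ U) ^ (1 / p) := by
          rw [ENNReal.mul_rpow_of_nonneg _ _ (by positivity), ← ENNReal.rpow_mul,
            mul_one_div_cancel hp0.ne', ENNReal.rpow_one]
      _ ≤ _ := by
          gcongr
          rw [← setLIntegral_const]
          refine le_trans (setLIntegral_mono' hUo.measurableSet fun y hy => ?_)
            (setLIntegral_le_lintegral U _)
          exact ENNReal.rpow_le_rpow (le_of_lt hy) hp0.le
  · set K := closure {x | Φ x ≠ 0} with hK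
    have hKt : μ K + 1 ≠ ∞ := by simpa using hΦ.2.measure_ne_top
    have hlim : Tendsto (fun p : ℝ => L * (μ K + 1) ^ (1 / p)) atTop (𝓝 (L * 1)) :=
      ENNReal.Tendsto.const_mul (tendsto_const_rpow_one_div (by simp) hKt) (.inl one_ne_zero)
    rw [mul_one] at hlim
    filter_upwards [hlim.eventually (gt_mem_nhds ha), eventually_gt_atTop 0] with p hp hp0
    refine lt_of_le_of_lt (piNorm_le fun ξ hξ => ?_) hp
    calc (∫⁻ x, ‖π.op (Φ x) ξ‖ₑ ^ p ∂μ) ^ (1 / p)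
        ≤ (∫⁻ x in K, L ^ p ∂μ) ^ (1 / p) := by
          refine ENNReal.rpow_le_rpow ?_ (by positivity)
          rw [← lintegral_indicator isClosed_closure.measurableSet]
          refine lintegral_mono_ae ?_
          filter_upwards [ENNReal.ae_le_essSup (μ := μ) fun x => ‖Φ x‖ₑ] with x hx
          by_cases hxK : x ∈ K
          · rw [Set.indicator_of_mem hxK]
            exact ENNReal.rpow_le_rpow ((hπ.enorm_op_apply_le _ hξ).trans hx) hp0.le
          · have : Φ x = 0 := by
              by_contra h
              exact hxK (subset_closure h)
            simp [this, π.op_zero, hp0]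
      _ = L * μ K ^ (1 / p) := by
          rw [setLIntegral_const, ENNReal.mul_rpow_of_nonneg _ _ (by positivity),
            ← ENNReal.rpow_mul, mul_one_div_cancel hp0.ne', ENNReal.rpow_one]
      _ ≤ L * (μ K + 1) ^ (1 / p) := by gcongr; exact le_self_add

variable [IsTopologicalGroup G]

theorem IsIsometric.enorm_op_conv_le [IsFiniteMeasureOnCompacts μ] (hπ : π.IsIsometric)
    {Ψ Φ : ∀ x, C x} (hΨ : IsCc Ψ) (hΦ : IsCc Φ) (x : G) (ξ : H) :
    ‖π.op (conv μ Ψ Φ x) ξ‖ₑ ≤ ∫⁻ y, ‖(‖Ψ y‖)‖ₑ * ‖(‖π.op (Φ (y⁻¹ * x)) ξ‖)‖ₑ ∂μ := by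
  rw [conv_eq, hπ.op_integral (hΨ.integrable_conv μ hΦ x)]
  refine (enorm_integral_le_lintegral_enorm _).trans (lintegral_mono fun y => ?_)
  rw [op_mulTo, enorm_norm, enorm_norm, ← hπ.enorm_op]
  exact (π.op (Ψ y)).le_opENorm _

variable [T2Space G] [LocallyCompactSpace G] [μ.IsHaarMeasure] [μ.IsMulRightInvariant]

theorem IsIsometric.piNorm_conv_le (hπ : π.IsIsometric) {Ψ Φ : ∀ x, C x} (hΨ : IsCc Ψ)
    (hΦ : IsCc Φ) {p q r : ℝ} (hp : 1 ≤ p) (hq : 1 ≤ q) (hr : 1 ≤ r)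
    (h : 1 / p + 1 / q = 1 + 1 / r) :
    π.piNorm μ r (conv μ Ψ Φ) ≤ lpNorm μ p Ψ * π.piNorm μ q Φ := by
  refine piNorm_le fun ξ hξ => ?_
  have hY := young_inequality μ hΨ.continuous_norm hΨ.hasCompactSupport_norm
    (π.continuous_op_section hΦ ξ).norm (π.hasCompactSupport_op_section hΦ ξ) hp hq hr h
  refine le_trans ?_ (hY.trans ?_)
  · gcongr with x
    exact hπ.enorm_op_conv_le hΨ hΦ x ξ
  · simp only [enorm_norm]
    exact mul_le_mul' le_rfl (le_piNorm q Φ hξ)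

theorem IsIsometric.linftyNorm_conv_le (hπ : π.IsIsometric) {Ψ Φ : ∀ x, C x} (hΨ : IsCc Ψ)
    (hΦ : IsCc Φ) {p q : ℝ} (hpq : p.HolderConjugate q) :
    linftyNorm μ (conv μ Ψ Φ) ≤ lpNorm μ p Ψ * π.piNorm μ q Φ := by
  refine essSup_le_of_ae_le _ (.of_forall fun x => ?_)
  refine (hπ.enorm_op _).symm.trans_le ?_
  refine ContinuousLinearMap.opENorm_le_bound _ fun ξ => ?_
  have hH := lintegral_mul_translate_le μ hΨ.continuous_norm
    (π.continuous_op_section hΦ ξ).norm (π.hasCompactSupport_op_section hΦ ξ) hpq x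
  refine (hπ.enorm_op_conv_le hΨ hΦ x ξ).trans (hH.trans ?_)
  simp only [enorm_norm]
  rw [_root_.mul_assoc]
  exact mul_le_mul' le_rfl (lintegral_op_le_piNorm π μ hpq.symm.pos Φ ξ)

end Norm

end Representation
end Representation

/-! ### Discrete groups and the regular representation -/

section Discrete

theorem ext_count {G : Type*} [MeasurableSpace G] {H : Type*} [NormedAddCommGroup H]
    {η ζ : Lp H 2 (Measure.count : Measure G)} (h : ∀ x, η x = ζ x) : η = ζ :=
  Lp.ext (.of_forall h)

variable {G : Type*} [MeasurableSpace G] [MeasurableSingletonClass G]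

theorem le_lintegral_count_rpow (f : G → ℝ≥0∞) {q : ℝ} (hq : 0 < q) (x : G) :
    f x ≤ (∫⁻ x, f x ^ q ∂Measure.count) ^ (1 / q) := by
  have h : f x ^ q ≤ ∫⁻ x, f x ^ q ∂Measure.count := by
    have := setLIntegral_le_lintegral (μ := Measure.count) {x} fun x => f x ^ q
    rwa [lintegral_singleton, Measure.count_singleton, mul_one] at this
  refine le_of_eq_of_le ?_ (ENNReal.rpow_le_rpow h (by positivity : 0 ≤ 1 / q))
  rw [← ENNReal.rpow_mul, mul_one_div_cancel hq.ne', ENNReal.rpow_one]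

theorem forall_of_ae_count {p : G → Prop} (h : ∀ᵐ x ∂(Measure.count : Measure G), p x) (x : G) :
    p x := by
  by_contra hx
  have h0 : (Measure.count : Measure G) {x} = 0 :=
    measure_mono_null (by simpa using hx) (ae_iff.1 h)
  simp at h0

end Discrete

section FiniteSupport

variable {G : Type*} [Group G] [TopologicalSpace G] {C : G → Type*}
  [∀ x, NormedAddCommGroup (C x)] [∀ x, NormedSpace ℂ (C x)] [∀ x, CompleteSpace (C x)]
  [TopologicalSpace (FellTotal C)] [FellBundle C]

theorem finite_support_invol {Φ : ∀ x, C x} (hΦ : {x | Φ x ≠ 0}.Finite) :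
    {x | invol Φ x ≠ 0}.Finite := by
  refine (hΦ.preimage (f := fun x => x⁻¹) inv_injective.injOn).subset fun x hx h => hx ?_
  rw [← norm_eq_zero]
  exact (norm_adjTo (inv_inv x) _).trans (by rw [h, norm_zero])

theorem conv_count_eq_sum [MeasurableSpace G] [MeasurableSingletonClass G]
    {Ψ Φ : ∀ x, C x} {S : Finset G} (hS : ∀ x, Ψ x ≠ 0 → x ∈ S) (x : G) :
    conv Measure.count Ψ Φ x =
      ∑ y ∈ S, mulTo (mul_inv_cancel_left y x) (Ψ y) (Φ (y⁻¹ * x)) := by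
  rw [conv_eq, ← setIntegral_eq_integral_of_forall_compl_eq_zero (s := S), setIntegral_finset]
  · simp
  · rw [← Set.biUnion_of_singleton (S : Set G)]
    exact integrableOn_finset_iUnion.2 fun y _ => integrableOn_singleton enorm_ne_top (by simp)
  · intro y hy
    have : Ψ y = 0 := by
      by_contra h
      exact hy (hS y h)
    rw [this, zero_mulTo]

end FiniteSupport

section RegularRepresentation

variable {G : Type*} [Group G] [TopologicalSpace G] {C : G → Type*}
  [∀ x, NormedAddCommGroup (C x)] [∀ x, NormedSpace ℂ (C x)] [∀ x, CompleteSpace (C x)]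
  [TopologicalSpace (FellTotal C)] [FellBundle C]
  {H : Type*} [NormedAddCommGroup H] [InnerProductSpace ℂ H] [CompleteSpace H]
  (π : Representation C H) [MeasurableSpace G] [MeasurableMul G]

namespace Representation

/-- The operator `η ↦ (x ↦ π(a) η(y⁻¹ x))` on the square summable functions, for `a` in the fibre
over `y`: the image of `a` under the representation of the bundle induced from `π`. -/
noncomputable def regOp (y : G) (a : C y) :
    Lp H 2 (Measure.count : Measure G) →L[ℂ] Lp H 2 (Measure.count : Measure G) :=
  (π.op a).compLpL 2 Measure.count ∘L (Lp.compMeasurePreservingₗᵢ ℂ (fun x => y⁻¹ * x)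
    (measurePreserving_mul_left Measure.count y⁻¹)).toContinuousLinearMap

variable {π} in
theorem IsIsometric.norm_regOp_le (hπ : π.IsIsometric) (y : G) (a : C y) :
    ‖π.regOp y a‖ ≤ ‖a‖ := by
  refine (ContinuousLinearMap.opNorm_comp_le _ _).trans ?_
  rw [← hπ y a, ← mul_one ‖π.op a‖]
  exact mul_le_mul (ContinuousLinearMap.norm_compLpL_le _)
    (LinearIsometry.norm_toContinuousLinearMap_le _) (norm_nonneg _) (norm_nonneg _)

variable [MeasurableSingletonClass G]

theorem regOp_apply (y : G) (a : C y) (η : Lp H 2 (Measure.count : Measure G)) (x : G) :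
    π.regOp y a η x = π.op a (η (y⁻¹ * x)) := by
  have h1 := forall_of_ae_count (ContinuousLinearMap.coeFn_compLpL (𝕜' := ℂ) (p := 2) (π.op a)
    (Lp.compMeasurePreserving (fun x => y⁻¹ * x)
      (measurePreserving_mul_left (Measure.count : Measure G) y⁻¹) η)) x
  have h2 := forall_of_ae_count (Lp.coeFn_compMeasurePreserving η
    (measurePreserving_mul_left (Measure.count : Measure G) y⁻¹)) x
  exact h1.trans (congrArg _ h2)

/-- Evaluation at a point of a square summable function. -/
noncomputable def evalAt (x : G) : Lp H 2 (Measure.count : Measure G) →+ H where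
  toFun η := η x
  map_zero' := forall_of_ae_count (Lp.coeFn_zero H 2 Measure.count) x
  map_add' η ζ := forall_of_ae_count (Lp.coeFn_add η ζ) x

theorem regOp_add (y : G) (a b : C y) : π.regOp y (a + b) = π.regOp y a + π.regOp y b := by
  ext1 η
  refine ext_count fun x => ?_
  rw [_root_.add_apply, forall_of_ae_count (Lp.coeFn_add _ _) x, Pi.add_apply]
  simp only [regOp_apply, π.map_add, _root_.add_apply]

theorem regOp_smul (y : G) (t : ℂ) (a : C y) : π.regOp y (t • a) = t • π.regOp y a := by
  ext1 η
  refine ext_count fun x => ?_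
  rw [_root_.smul_apply, forall_of_ae_count (Lp.coeFn_smul _ _) x, Pi.smul_apply]
  simp only [regOp_apply, π.map_smul, _root_.smul_apply]

theorem regOp_mulTo {x y z : G} (h : x * y = z) (a : C x) (b : C y) :
    π.regOp z (mulTo h a b) = π.regOp x a * π.regOp y b := by
  ext1 η
  refine ext_count fun w => ?_
  change _ = π.regOp x a (π.regOp y b η) w
  simp only [regOp_apply, π.op_mulTo, ContinuousLinearMap.comp_apply]
  rw [← h, mul_inv_rev, _root_.mul_assoc]

theorem regOp_adjTo {y z : G} (h : y⁻¹ = z) (a : C y) :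
    π.regOp z (adjTo h a) = star (π.regOp y a) := by
  rw [ContinuousLinearMap.star_eq_adjoint, ContinuousLinearMap.eq_adjoint_iff]
  intro η ζ
  rw [L2.inner_def, L2.inner_def, ← integral_mul_left_eq_self _ y⁻¹]
  refine integral_congr_ae (.of_forall fun x => ?_)
  simp only [regOp_apply, π.op_adjTo, ContinuousLinearMap.adjoint_inner_left, ← h]
  simp

theorem regOp_zero (y : G) : π.regOp y (0 : C y) = 0 := by
  have h := π.regOp_smul y 0 0
  rwa [zero_smul, zero_smul] at h

/-- The regular representation induced from `π`, on finitely supported sections; it has the value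
`0` on the sections for which the sum is not finite. -/
noncomputable def reg (Φ : ∀ x, C x) :
    Lp H 2 (Measure.count : Measure G) →L[ℂ] Lp H 2 (Measure.count : Measure G) :=
  ∑ᶠ y, π.regOp y (Φ y)

theorem support_regOp_subset (Φ : ∀ x, C x) :
    (Function.support fun y => π.regOp y (Φ y)) ⊆ {x | Φ x ≠ 0} := fun y hy h =>
  hy (by simp only [h, regOp_zero])

theorem reg_add {Φ Ψ : ∀ x, C x} (hΦ : {x | Φ x ≠ 0}.Finite) (hΨ : {x | Ψ x ≠ 0}.Finite) :
    π.reg (Φ + Ψ) = π.reg Φ + π.reg Ψ := by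
  rw [reg, reg, reg, ← finsum_add_distrib (hΦ.subset (π.support_regOp_subset Φ))
    (hΨ.subset (π.support_regOp_subset Ψ))]
  exact finsum_congr fun y => π.regOp_add y _ _

theorem reg_smul (t : ℂ) {Φ : ∀ x, C x} (hΦ : {x | Φ x ≠ 0}.Finite) :
    π.reg (t • Φ) = t • π.reg Φ := by
  rw [reg, reg, smul_finsum' t (hΦ.subset (π.support_regOp_subset Φ))]
  exact finsum_congr fun y => π.regOp_smul y t _

theorem reg_eq_sum {Φ : ∀ x, C x} {S : Finset G} (hS : ∀ x, Φ x ≠ 0 → x ∈ S) :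
    π.reg Φ = ∑ y ∈ S, π.regOp y (Φ y) :=
  finsum_eq_sum_of_support_subset _ ((π.support_regOp_subset Φ).trans hS)

theorem reg_invol (Φ : ∀ x, C x) : π.reg (invol Φ) = star (π.reg Φ) := by
  have h : ∀ x, π.regOp x (invol Φ x) = starAddEquiv (π.regOp x⁻¹ (Φ x⁻¹)) :=
    fun x => π.regOp_adjTo (inv_inv x) (Φ x⁻¹)
  rw [reg, finsum_congr h, ← AddEquiv.map_finsum]
  exact congrArg star (finsum_comp_equiv (Equiv.inv G) (f := fun y => π.regOp y (Φ y)))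

theorem reg_conv {Ψ Φ : ∀ x, C x} (hΨ : {x | Ψ x ≠ 0}.Finite) (hΦ : {x | Φ x ≠ 0}.Finite) :
    π.reg (conv Measure.count Ψ Φ) = π.reg Ψ * π.reg Φ := by
  set S := hΨ.toFinset with hS
  have hS' : ∀ x, Ψ x ≠ 0 → x ∈ S := fun x hx => hΨ.mem_toFinset.2 hx
  have hfin : ∀ y, (Function.support fun x => π.regOp (y⁻¹ * x) (Φ (y⁻¹ * x))).Finite :=
    fun y => (hΦ.subset (π.support_regOp_subset Φ)).preimage
      ((mul_right_injective y⁻¹).injOn (s := _))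
  have h : ∀ x, π.regOp x (conv Measure.count Ψ Φ x) =
      ∑ y ∈ S, π.regOp y (Ψ y) * π.regOp (y⁻¹ * x) (Φ (y⁻¹ * x)) := fun x => by
    rw [conv_count_eq_sum hS']
    exact (map_sum (AddMonoidHom.mk' (π.regOp x) (π.regOp_add x)) _ _).trans
      (Finset.sum_congr rfl fun y _ => π.regOp_mulTo _ _ _)
  rw [reg, finsum_congr h, finsum_sum_comm, π.reg_eq_sum hS', Finset.sum_mul]
  · refine Finset.sum_congr rfl fun y _ => ?_
    rw [← mul_finsum' _ _ (hfin y)]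
    congr 1
    exact finsum_comp_equiv (Equiv.mulLeft y⁻¹) (f := fun x => π.regOp x (Φ x))
  · intro y _
    exact (hfin y).subset fun x hx h0 => hx (by simp only [h0, mul_zero])

variable {π} in
theorem IsIsometric.norm_reg_le (hπ : π.IsIsometric) {Φ : ∀ x, C x}
    (hΦ : {x | Φ x ≠ 0}.Finite) :
    ENNReal.ofReal ‖π.reg Φ‖ ≤ lpNorm Measure.count 1 Φ := by
  rw [π.reg_eq_sum (S := hΦ.toFinset) fun x hx => hΦ.mem_toFinset.2 hx, lpNorm]
  simp only [ENNReal.rpow_one, div_one, lintegral_count]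
  refine le_trans ?_ (ENNReal.sum_le_tsum hΦ.toFinset)
  simp only [← ofReal_norm]
  rw [← ENNReal.ofReal_sum_of_nonneg fun _ _ => norm_nonneg _]
  exact ENNReal.ofReal_le_ofReal
    ((norm_sum_le _ _).trans (Finset.sum_le_sum fun y _ => hπ.norm_regOp_le y _))

/-- The vector `π(Φ(·)) ξ` is the image under the regular representation of the function which is
`ξ` at the unit and vanishes elsewhere. -/
theorem piNorm_two_le_norm_reg {Φ : ∀ x, C x} (hΦ : {x | Φ x ≠ 0}.Finite) :
    π.piNorm Measure.count 2 Φ ≤ ENNReal.ofReal ‖π.reg Φ‖ := by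
  classical
  refine piNorm_le fun ξ hξ => ?_
  have h1 : (Measure.count : Measure G) {1} ≠ ∞ := by simp
  set δ : Lp H 2 (Measure.count : Measure G) :=
    indicatorConstLp 2 (measurableSet_singleton (1 : G)) h1 ξ with hδ
  have hδx : ∀ x, δ x = Set.indicator {1} (fun _ => ξ) x := fun x =>
    forall_of_ae_count indicatorConstLp_coeFn x
  have hδn : ‖δ‖ ≤ 1 := by
    rw [hδ, norm_indicatorConstLp two_ne_zero ENNReal.ofNat_ne_top]
    simpa [Measure.real] using hξ
  have happ : ∀ x, π.reg Φ δ x = π.op (Φ x) ξ := fun x => by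
    rw [π.reg_eq_sum (S := insert x hΦ.toFinset)
      fun x hx => Finset.mem_insert_of_mem (hΦ.mem_toFinset.2 hx),
      _root_.sum_apply]
    refine (map_sum (evalAt (H := H) x) _ _).trans ?_
    rw [Finset.sum_eq_single_of_mem x (Finset.mem_insert_self _ _)]
    · refine (π.regOp_apply x (Φ x) δ x).trans ?_
      rw [hδx]; simp
    · intro y _ hy
      refine (π.regOp_apply y (Φ y) δ x).trans ?_
      rw [hδx, Set.indicator_of_notMem, map_zero]
      rwa [Set.mem_singleton_iff, inv_mul_eq_one]
  have hnorm : (∫⁻ x, ‖π.op (Φ x) ξ‖ₑ ^ (2 : ℝ) ∂Measure.count) ^ (1 / (2 : ℝ)) =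
      ‖π.reg Φ δ‖ₑ := by
    rw [Lp.enorm_def, eLpNorm_eq_lintegral_rpow_enorm_toReal two_ne_zero ENNReal.ofNat_ne_top]
    simp only [happ, ENNReal.toReal_ofNat]
  rw [hnorm, ← ofReal_norm]
  refine ENNReal.ofReal_le_ofReal (((π.reg Φ).le_opNorm δ).trans ?_)
  exact mul_le_of_le_one_right (norm_nonneg _) hδn

end Representation

end RegularRepresentation

section DiscreteGroup

theorem IsCc.finite {G : Type*} [TopologicalSpace G] [DiscreteTopology G] {C : G → Type*}
    [∀ x, NormedAddCommGroup (C x)] [TopologicalSpace (FellTotal C)] {Φ : ∀ x, C x}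
    (hΦ : IsCc Φ) : {x | Φ x ≠ 0}.Finite :=
  hΦ.2.finite_of_discrete.subset subset_closure

variable {G : Type*} [Group G] [TopologicalSpace G] [DiscreteTopology G] {C : G → Type*}
  [∀ x, NormedAddCommGroup (C x)] [∀ x, NormedSpace ℂ (C x)] [∀ x, CompleteSpace (C x)]
  [TopologicalSpace (FellTotal C)] [FellBundle C] [MeasurableSpace G] [BorelSpace G]
  {H : Type*} [NormedAddCommGroup H] [InnerProductSpace ℂ H] [CompleteSpace H]
  {π : Representation C H}

theorem Representation.IsIsometric.isCStarSeminorm_reg (hπ : π.IsIsometric) :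
    IsCStarSeminorm Measure.count fun Φ : ∀ x, C x => ‖π.reg Φ‖ where
  add_le Φ Ψ hΦ hΨ := by
    rw [π.reg_add hΦ.finite hΨ.finite]
    exact norm_add_le _ _
  smul_eq t Φ hΦ := by rw [π.reg_smul t hΦ.finite, norm_smul]
  conv_le Φ Ψ hΦ hΨ := by
    rw [π.reg_conv hΦ.finite hΨ.finite]
    exact _root_.norm_mul_le _ _
  conv_invol_self Φ hΦ := by
    rw [π.reg_conv (finite_support_invol hΦ.finite) hΦ.finite, π.reg_invol,
      sq]
    exact ContinuousLinearMap.norm_adjoint_comp_self _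
  le_lpNorm_one Φ hΦ := hπ.norm_reg_le hΦ.finite

theorem Representation.IsIsometric.l2eNorm_le_cstarNorm
    [IsFiniteMeasureOnCompacts (Measure.count : Measure G)] (hπ : π.IsIsometric) {Φ : ∀ x, C x}
    (hΦ : IsCc Φ) : l2eNorm Measure.count Φ ≤ cstarNorm Measure.count Φ := by
  rw [← hπ.piNorm_two hΦ]
  exact (π.piNorm_two_le_norm_reg hΦ.finite).trans
    (le_iSup (fun N : {N : (∀ x, C x) → ℝ // IsCStarSeminorm Measure.count N} =>
      ENNReal.ofReal (N.1 Φ)) ⟨_, hπ.isCStarSeminorm_reg⟩)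

end DiscreteGroup

section DiscreteNorms

variable {G : Type*} [Group G] [TopologicalSpace G] {C : G → Type*}
  [∀ x, NormedAddCommGroup (C x)] [∀ x, NormedSpace ℂ (C x)] [∀ x, CompleteSpace (C x)]
  [TopologicalSpace (FellTotal C)] [FellBundle C]
  {H : Type*} [NormedAddCommGroup H] [InnerProductSpace ℂ H] [CompleteSpace H]
  {π : Representation C H} [MeasurableSpace G] [MeasurableSingletonClass G]

theorem Representation.IsIsometric.linftyNorm_le_piNorm_count (hπ : π.IsIsometric)
    (Φ : ∀ x, C x) {q : ℝ} (hq : 0 < q) :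
    linftyNorm Measure.count Φ ≤ π.piNorm Measure.count q Φ := by
  refine essSup_le_of_ae_le _ (.of_forall fun x => ?_)
  refine (hπ.enorm_op _).symm.trans_le (ContinuousLinearMap.opENorm_le_bound _ fun ξ => ?_)
  exact (le_lintegral_count_rpow (fun x => ‖π.op (Φ x) ξ‖ₑ) hq x).trans
    (π.lintegral_op_le_piNorm _ hq Φ ξ)

theorem Representation.piNorm_count_antitone (π : Representation C H) (Φ : ∀ x, C x) {p q : ℝ}
    (hp : 0 < p) (hpq : p ≤ q) : π.piNorm Measure.count q Φ ≤ π.piNorm Measure.count p Φ :=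
  piNorm_le fun ξ hξ => (lintegral_rpow_antitone_of_le _ hp hpq
    (le_lintegral_count_rpow (fun x => ‖π.op (Φ x) ξ‖ₑ) hp)).trans (le_piNorm p Φ hξ)

end DiscreteNorms

end FellBundle

theorem mainTheorem8 {G : Type*} [Group G] [TopologicalSpace G] [IsTopologicalGroup G]
    [T2Space G] [LocallyCompactSpace G] [MeasurableSpace G] [BorelSpace G]
    (μ : Measure G) [μ.IsHaarMeasure] [μ.IsMulRightInvariant]
    (C : G → Type*) [∀ x, NormedAddCommGroup (C x)] [∀ x, NormedSpace ℂ (C x)]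
    [∀ x, CompleteSpace (C x)] [TopologicalSpace (FellTotal C)] [FellBundle C] :
    (∀ (H : Type*) [NormedAddCommGroup H] [InnerProductSpace ℂ H] [CompleteSpace H]
      (π : FellBundle.Representation C H), π.IsIsometric → π.IsNondegenerate →
      ∀ Φ Ψ : (∀ x, C x), FellBundle.IsCc Φ → FellBundle.IsCc Ψ →
        (∀ p : ℝ, 1 ≤ p →
          FellBundle.lpNorm μ p Φ = (∫⁻ x, ‖π.op (Φ x)‖ₑ ^ p ∂μ) ^ (1 / p)) ∧
        π.piNorm μ 2 Φ = FellBundle.l2eNorm μ Φ ∧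
        Tendsto (fun p : ℝ => π.piNorm μ p Φ) atTop (𝓝 (FellBundle.linftyNorm μ Φ)) ∧
        (∀ p q r : ℝ, 1 ≤ p → 1 ≤ q → 1 ≤ r → 1 / p + 1 / q = 1 + 1 / r →
          π.piNorm μ r (FellBundle.conv μ Ψ Φ) ≤ FellBundle.lpNorm μ p Ψ * π.piNorm μ q Φ) ∧
        (∀ p q : ℝ, 1 ≤ p → 1 ≤ q → 1 / p + 1 / q = 1 →
          FellBundle.linftyNorm μ (FellBundle.conv μ Ψ Φ) ≤
            FellBundle.lpNorm μ p Ψ * π.piNorm μ q Φ) ∧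
        (DiscreteTopology G → μ = Measure.count →
          (∀ p q : ℝ, 1 ≤ p → p ≤ q →
            FellBundle.linftyNorm μ Φ ≤ π.piNorm μ q Φ ∧ π.piNorm μ q Φ ≤ π.piNorm μ p Φ) ∧
          FellBundle.l2eNorm μ Φ ≤ FellBundle.cstarNorm μ Φ)) ∧
    (∀ Φ Ψ : (∀ x, C x), FellBundle.IsCc Φ → FellBundle.IsCc Ψ →
      FellBundle.linftyNorm μ (FellBundle.conv μ Ψ Φ) ≤
        FellBundle.lpNorm μ 2 Ψ * FellBundle.l2eNorm μ Φ) := by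
  refine ⟨fun H _ _ _ π hπ _ Φ Ψ hΦ hΨ => ⟨fun p _ => hπ.lpNorm_eq p Φ, hπ.piNorm_two hΦ,
    hπ.tendsto_piNorm hΦ, fun p q r hp hq hr h => hπ.piNorm_conv_le hΨ hΦ hp hq hr h,
    fun p q hp hq h => ?_, ?_⟩, fun Φ Ψ hΦ hΨ => FellBundle.linftyNorm_conv_le μ hΨ hΦ⟩
  · have hp0 : 0 < p := by linarith
    have hq0 : 0 < q := by linarith
    have hpq : p.HolderConjugate q :=
      Real.holderConjugate_iff.2 ⟨by
        by_contra! h1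
        have : 1 / p = 1 := by rw [le_antisymm h1 hp, div_one]
        have : 0 < 1 / q := by positivity
        linarith, by simpa only [one_div] using h⟩
    exact hπ.linftyNorm_conv_le hΨ hΦ hpq
  · rintro _ rfl
    exact ⟨fun p q hp hpq => ⟨hπ.linftyNorm_le_piNorm_count Φ (by linarith),
      π.piNorm_count_antitone Φ (by linarith) hpq⟩, hπ.l2eNorm_le_cstarNorm hΦ⟩
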